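/- Let $\Bbbk$ be an algebraically closed field of characteristic zero, let $n\ge 1$, and let $A=Q_n$ be the quotient of the path algebra over $\Bbbk$ of the oriented cycle with vertices $i\in\mathbb{Z}/n$ and arrows $\alpha_i\colon i\to i+1$ by all paths of length two (so $Q_1=\Bbbk[x]/(x^2)$). Paths are composed from right to left, and $\varepsilon_i$ denotes the idempotent of the vertex $i$. Bimodules are finite dimensional $A$-$A$-bimodules on which $\Bbbk$ acts centrally. A bimodule is called *$\Bbbk$-split* if it is isomorphic to $M\otimes_{\Bbbk}N$ for a finite dimensional left $A$-module $M$ and a finite dimensional right $A$-module $N$. Let $v=i|j$ be a vertex of $\mathbb{Z}^2$ (row $i$, column $j$), let $c\in\{\text{right},\text{down}\}$ and let $l\ge 0$. Consider the walk $v=v_0,v_1,\dots,v_l$ in $\mathbb{Z}^2$ whose steps go alternately to the right ($i|j\mapsto i|j+1$) and down ($i|j\mapsto i+1|j$), the first step being of kind $c$. The *string bimodule* $X(v,c,l)$ has basis $x_0,\dots,x_l$; if $v_m=a|b$, then $\varepsilon_a x_m=x_m=x_m\varepsilon_b$; moreover $\alpha_a x_m=x_{m+1}$ if the step from $v_m=a|b$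 to $v_{m+1}$ goes down, and $x_{m+1}\alpha_b=x_m$ if the step from $v_m=a|b$ to $v_{m+1}$ goes to the right; all other actions of the $\varepsilon$'s and $\alpha$'s on basis vectors are zero (indices of $\varepsilon$ and $\alpha$ are taken modulo $n$). A string bimodule is a bimodule isomorphic to some $X(v,c,l)$. Its *width* is the number of columns, and its *height* the number of rows, of $\mathbb{Z}^2$ that contain a vertex of the walk, and its *number of valleys* is the number of $m$ with $0<m<l$ such that the step from $v_{m-1}$ to $v_m$ goes down and the step from $v_m$ to $v_{m+1}$ goes to the right. **Proposition 3.5.** Let $X$ and $Y$ be string $A$-$A$-bimodules. Then $X\otimes_A Y$ is isomorphic to a finite direct sum $\bigoplus_i Z_i$ of bimodules $Z_i$ each of which is a string bimodule or a $\Bbbk$-split bimodule, and such that for every $i$ for which $Z_i$ is a string bimodule, the number of valleys and the width of $Z_i$ do not exceed those of $Y$, and the number of valleys and the height of $Z_i$ do not exceed those of $X$. -/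

import Mathlib

open scoped TensorProduct

universe u

/-! ## The algebra `Q_n` -/

/-- The radical square zero Nakayama algebra `Q_n` over `k`: the path algebra of the oriented cycle
with vertices `i ∈ ℤ/n` and arrows `α_i : i ⟶ i + 1`, modulo all paths of length two.
The residue classes of the paths of length at most one form a basis: `x.1 i` is the coefficient of
the idempotent `ε_i` and `x.2 i` is the coefficient of the arrow `α_i`.
For `n = 1` this is the algebra of dual numbers `k[x]/(x²)`. -/
def NakayamaAlgebra (k : Type u) (n : ℕ) : Type u := (ZMod n → k) × (ZMod n → k)

namespace NakayamaAlgebra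

variable {k : Type u} {n : ℕ}

@[ext] theorem ext {x y : NakayamaAlgebra k n} (h₁ : ∀ i, x.1 i = y.1 i) (h₂ : ∀ i, x.2 i = y.2 i) :
    x = y := Prod.ext (funext h₁) (funext h₂)

variable [Field k]

instance : AddCommGroup (NakayamaAlgebra k n) :=
  inferInstanceAs (AddCommGroup ((ZMod n → k) × (ZMod n → k)))

instance : Module k (NakayamaAlgebra k n) :=
  inferInstanceAs (Module k ((ZMod n → k) × (ZMod n → k)))

/-- The unit is the sum of all `ε_i`. -/
instance : One (NakayamaAlgebra k n) := ⟨(fun _ => 1, fun _ => 0)⟩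

/-- Paths are composed from right to left: `ε_i ε_i = ε_i`, `ε_{i+1} α_i = α_i = α_i ε_i`, and all
other products of two of the elements `ε_i`, `α_j` are zero. -/
instance : Mul (NakayamaAlgebra k n) :=
  ⟨fun x y => (fun i => x.1 i * y.1 i, fun i => x.1 (i + 1) * y.2 i + x.2 i * y.1 i)⟩

@[simp] theorem zero_fst (i : ZMod n) : (0 : NakayamaAlgebra k n).1 i = 0 := rfl
@[simp] theorem zero_snd (i : ZMod n) : (0 : NakayamaAlgebra k n).2 i = 0 := rfl
@[simp] theorem one_fst (i : ZMod n) : (1 : NakayamaAlgebra k n).1 i = 1 := rfl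
@[simp] theorem one_snd (i : ZMod n) : (1 : NakayamaAlgebra k n).2 i = 0 := rfl
@[simp] theorem add_fst (x y : NakayamaAlgebra k n) (i : ZMod n) :
    (x + y).1 i = x.1 i + y.1 i := rfl
@[simp] theorem add_snd (x y : NakayamaAlgebra k n) (i : ZMod n) :
    (x + y).2 i = x.2 i + y.2 i := rfl
@[simp] theorem smul_fst (c : k) (x : NakayamaAlgebra k n) (i : ZMod n) :
    (c • x).1 i = c * x.1 i := rfl
@[simp] theorem smul_snd (c : k) (x : NakayamaAlgebra k n) (i : ZMod n) :
    (c • x).2 i = c * x.2 i := rfl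
@[simp] theorem mul_fst (x y : NakayamaAlgebra k n) (i : ZMod n) :
    (x * y).1 i = x.1 i * y.1 i := rfl
@[simp] theorem mul_snd (x y : NakayamaAlgebra k n) (i : ZMod n) :
    (x * y).2 i = x.1 (i + 1) * y.2 i + x.2 i * y.1 i := rfl

instance : Ring (NakayamaAlgebra k n) :=
  { (inferInstance : AddCommGroup (NakayamaAlgebra k n)),
    (inferInstance : One (NakayamaAlgebra k n)),
    (inferInstance : Mul (NakayamaAlgebra k n)) with
    left_distrib := fun x y z => by ext i <;> simp <;> ring
    right_distrib := fun x y z => by ext i <;> simp <;> ring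
    zero_mul := fun x => by ext i <;> simp
    mul_zero := fun x => by ext i <;> simp
    mul_assoc := fun x y z => by ext i <;> simp <;> ring
    one_mul := fun x => by ext i <;> simp
    mul_one := fun x => by ext i <;> simp }

instance : Algebra k (NakayamaAlgebra k n) :=
  Algebra.ofModule (fun c x y => by ext i <;> simp <;> ring) (fun c x y => by ext i <;> simp <;> ring)

end NakayamaAlgebra

/-! ## Bimodules -/

/-- An `A`-`A`-bimodule over a `k`-algebra `A`, on which `k` acts centrally: a `k`-vector space with
a left and a right action of `A` by `k`-linear maps, which commute with each other. The right action
`x ↦ x · a` is `right (op a)`. -/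
structure Bimodule (k A : Type u) [Field k] [Ring A] [Algebra k A] where
  carrier : Type u
  [addCommGroup : AddCommGroup carrier]
  [module : Module k carrier]
  left : A →ₐ[k] Module.End k carrier
  right : Aᵐᵒᵖ →ₐ[k] Module.End k carrier
  left_right : ∀ (a : A) (b : Aᵐᵒᵖ) (x : carrier), left a (right b x) = right b (left a x)

namespace Bimodule

variable {k A : Type u} [Field k] [Ring A] [Algebra k A]

attribute [instance] Bimodule.addCommGroup Bimodule.module

/-- Isomorphisms of bimodules. -/
structure Iso (X Y : Bimodule k A) where
  toEquiv : X.carrier ≃ₗ[k] Y.carrier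
  map_left : ∀ (a : A) (x : X.carrier), toEquiv (X.left a x) = Y.left a (toEquiv x)
  map_right : ∀ (a : Aᵐᵒᵖ) (x : X.carrier), toEquiv (X.right a x) = Y.right a (toEquiv x)

/-- The direct sum of a finite family of bimodules, with componentwise actions. -/
def directSum {m : ℕ} (Z : Fin m → Bimodule k A) : Bimodule k A where
  carrier := ∀ i, (Z i).carrier
  left := AlgHom.ofLinearMap
    { toFun := fun a => LinearMap.pi fun i => (Z i).left a ∘ₗ LinearMap.proj i
      map_add' := fun a b => by ext x i; simp
      map_smul' := fun c a => by ext x i; simp }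
    (by ext x i; simp) (fun a b => by ext x i; simp)
  right := AlgHom.ofLinearMap
    { toFun := fun a => LinearMap.pi fun i => (Z i).right a ∘ₗ LinearMap.proj i
      map_add' := fun a b => by ext x i; simp
      map_smul' := fun c a => by ext x i; simp }
    (by ext x i; simp) (fun a b => by ext x i; simp)
  left_right := fun a b x => by ext i; simp [left_right]

/-- The subspace of `X ⊗_k Y` spanned by all `x a ⊗ y - x ⊗ a y`. -/
def balanced (X Y : Bimodule k A) : Submodule k (X.carrier ⊗[k] Y.carrier) :=
  Submodule.span k {t | ∃ (x : X.carrier) (a : A) (y : Y.carrier),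
    t = X.right (MulOpposite.op a) x ⊗ₜ[k] y - x ⊗ₜ[k] Y.left a y}

theorem balanced_le_left (X Y : Bimodule k A) (a : A) :
    balanced X Y ≤ (balanced X Y).comap ((X.left a).rTensor Y.carrier) := by
  refine Submodule.span_le.2 ?_
  rintro _ ⟨x, b, y, rfl⟩
  exact Submodule.subset_span ⟨X.left a x, b, y, by simp [left_right]⟩

theorem balanced_le_right (X Y : Bimodule k A) (a : Aᵐᵒᵖ) :
    balanced X Y ≤ (balanced X Y).comap ((Y.right a).lTensor X.carrier) := by
  refine Submodule.span_le.2 ?_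
  rintro _ ⟨x, b, y, rfl⟩
  exact Submodule.subset_span ⟨x, b, Y.right a y, by simp [left_right]⟩

/-- The left action `a (x ⊗ y) = a x ⊗ y` on `X ⊗_A Y`. -/
def tensorLeft (X Y : Bimodule k A) :
    A →ₐ[k] Module.End k ((X.carrier ⊗[k] Y.carrier) ⧸ balanced X Y) :=
  AlgHom.ofLinearMap
    { toFun := fun a => (balanced X Y).mapQ (balanced X Y) ((X.left a).rTensor Y.carrier)
        (balanced_le_left X Y a)
      map_add' := fun a b => Submodule.linearMap_qext _ (TensorProduct.ext' fun x y => by simp)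
      map_smul' := fun c a => Submodule.linearMap_qext _ (TensorProduct.ext' fun x y => by simp) }
    (Submodule.linearMap_qext _ (TensorProduct.ext' fun x y => by simp))
    (fun a b => Submodule.linearMap_qext _ (TensorProduct.ext' fun x y => by simp))

/-- The right action `(x ⊗ y) a = x ⊗ y a` on `X ⊗_A Y`. -/
def tensorRight (X Y : Bimodule k A) :
    Aᵐᵒᵖ →ₐ[k] Module.End k ((X.carrier ⊗[k] Y.carrier) ⧸ balanced X Y) :=
  AlgHom.ofLinearMap
    { toFun := fun a => (balanced X Y).mapQ (balanced X Y) ((Y.right a).lTensor X.carrier)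
        (balanced_le_right X Y a)
      map_add' := fun a b => Submodule.linearMap_qext _ (TensorProduct.ext' fun x y => by simp)
      map_smul' := fun c a => Submodule.linearMap_qext _ (TensorProduct.ext' fun x y => by simp) }
    (Submodule.linearMap_qext _ (TensorProduct.ext' fun x y => by simp))
    (fun a b => Submodule.linearMap_qext _ (TensorProduct.ext' fun x y => by simp))

theorem tensorLeft_tensorRight (X Y : Bimodule k A) (a : A) (b : Aᵐᵒᵖ) :
    tensorLeft X Y a ∘ₗ tensorRight X Y b = tensorRight X Y b ∘ₗ tensorLeft X Y a :=
  Submodule.linearMap_qext _ (TensorProduct.ext' fun x y => by simp [tensorLeft, tensorRight])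

/-- The tensor product `X ⊗_A Y`: the quotient of `X ⊗_k Y` by the relations `x a ⊗ y = x ⊗ a y`,
with `a (x ⊗ y) = a x ⊗ y` and `(x ⊗ y) a = x ⊗ y a`. -/
def tensor (X Y : Bimodule k A) : Bimodule k A where
  carrier := (X.carrier ⊗[k] Y.carrier) ⧸ balanced X Y
  left := tensorLeft X Y
  right := tensorRight X Y
  left_right := fun a b t => LinearMap.congr_fun (tensorLeft_tensorRight X Y a b) t

/-- The bimodule `M ⊗_k N` for a left `A`-module `M` and a right `A`-module `N`, with
`a (m ⊗ n) = a m ⊗ n` and `(m ⊗ n) a = m ⊗ n a`. -/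
def outer (k A : Type u) [Field k] [Ring A] [Algebra k A]
    (M : Type u) [AddCommGroup M] [Module k M] [Module A M] [IsScalarTower k A M]
    (N : Type u) [AddCommGroup N] [Module k N] [Module Aᵐᵒᵖ N] [IsScalarTower k Aᵐᵒᵖ N] :
    Bimodule k A where
  carrier := M ⊗[k] N
  left := (Module.End.rTensorAlgHom k M N).comp (Algebra.lsmul k k M)
  right := (Module.End.lTensorAlgHom k N M).comp (Algebra.lsmul k k N)
  left_right := fun a b t => by
    have h : ((Algebra.lsmul k k M a).rTensor N) ∘ₗ ((Algebra.lsmul k k N b).lTensor M) =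
        ((Algebra.lsmul k k N b).lTensor M) ∘ₗ ((Algebra.lsmul k k M a).rTensor N) :=
      TensorProduct.ext' fun x y => by simp
    exact LinearMap.congr_fun h t

/-- A bimodule is `k`-split if it is isomorphic to `M ⊗_k N` for a finite dimensional left
`A`-module `M` and a finite dimensional right `A`-module `N`. -/
def IsKSplit (X : Bimodule k A) : Prop :=
  ∃ (M : Type u) (_ : AddCommGroup M) (_ : Module k M) (_ : Module A M) (_ : IsScalarTower k A M)
    (N : Type u) (_ : AddCommGroup N) (_ : Module k N) (_ : Module Aᵐᵒᵖ N)
    (_ : IsScalarTower k Aᵐᵒᵖ N),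
    FiniteDimensional k M ∧ FiniteDimensional k N ∧ Nonempty (Iso X (outer k A M N))

end Bimodule

/-! ## String bimodules -/

/-- The initial course of a walk. -/
inductive Course where
  | right
  | down

/-- The data `(v, c, l)` of a string bimodule: the initial vertex `v = row|col`, the initial course
`c` and the length `l` of the walk. (For `l = 0` the course plays no role.) -/
structure StringDatum (n : ℕ) where
  row : ZMod n
  col : ZMod n
  course : Course
  length : ℕ

namespace StringDatum

variable {n : ℕ} (p : StringDatum n)

/-- The `m`-th step of the walk (from its `m`-th vertex to its `(m+1)`-st vertex, counting from `0`)
goes down; otherwise it goes to the right. The two kinds of steps alternate. -/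
def IsDown (m : ℕ) : Prop :=
  match p.course with
  | .down => Even m
  | .right => Odd m

instance : DecidablePred p.IsDown := fun m => by
  unfold IsDown
  cases p.course <;> infer_instance

/-- The number of down steps among the first `m` steps. In the covering quiver with vertex set `ℤ²`,
the `m`-th vertex of the walk lies `rowOffset m` rows below the initial vertex. -/
def rowOffset : ℕ → ℕ
  | 0 => 0
  | m + 1 => rowOffset m + if p.IsDown m then 1 else 0

/-- The number of right steps among the first `m` steps. In the covering quiver with vertex set
`ℤ²`, the `m`-th vertex of the walk lies `colOffset m` columns to the right of the initial vertex. -/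
def colOffset : ℕ → ℕ
  | 0 => 0
  | m + 1 => colOffset m + if p.IsDown m then 0 else 1

/-- The row (modulo `n`) of the `m`-th vertex of the walk. -/
def rowAt (m : ℕ) : ZMod n := p.row + p.rowOffset m

/-- The column (modulo `n`) of the `m`-th vertex of the walk. -/
def colAt (m : ℕ) : ZMod n := p.col + p.colOffset m

/-- The number of non-zero columns of the representation of the covering quiver. -/
def width : ℕ := ((Finset.range (p.length + 1)).image p.colOffset).card

/-- The number of non-zero rows of the representation of the covering quiver. -/
def height : ℕ := ((Finset.range (p.length + 1)).image p.rowOffset).card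

/-- The number of valleys, i.e. of the vertices of the walk with two incoming non-zero arrows: the
vertical arrow of a down step ending there, and the horizontal arrow of a right step starting there
(horizontal arrows point to the left). -/
def valleys : ℕ :=
  ((Finset.range p.length).filter fun m => 0 < m ∧ p.IsDown (m - 1) ∧ ¬ p.IsDown m).card

theorem isDown_succ (m : ℕ) : p.IsDown (m + 1) ↔ ¬ p.IsDown m := by
  unfold IsDown
  cases p.course <;> simp [Nat.even_add_one, Nat.odd_add_one]

theorem rowAt_succ {m : ℕ} (h : p.IsDown m) : p.rowAt (m + 1) = p.rowAt m + 1 := by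
  simp [rowAt, rowOffset, h, add_assoc]

theorem colAt_succ {m : ℕ} (h : ¬ p.IsDown m) : p.colAt (m + 1) = p.colAt m + 1 := by
  simp [colAt, colOffset, h, add_assoc]

theorem rowAt_succ_of_not_isDown {m : ℕ} (h : ¬ p.IsDown m) : p.rowAt (m + 1) = p.rowAt m := by
  simp [rowAt, rowOffset, h]

theorem colAt_succ_of_isDown {m : ℕ} (h : p.IsDown m) : p.colAt (m + 1) = p.colAt m := by
  simp [colAt, colOffset, h]

variable (k : Type u) [Field k]

/-- The left action on the basis `x_0, …, x_l`: `ε_i x_m = x_m` if `x_m` lies in row `i`,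
and `α_i x_m = x_{m+1}` if `x_m` lies in row `i` and the `m`-th step goes down; everything else
is zero. The entry at `(m', m)` is the coefficient of `x_{m'}` in `a x_m`. -/
def leftMatrix (a : NakayamaAlgebra k n) : Matrix (Fin (p.length + 1)) (Fin (p.length + 1)) k :=
  Matrix.of fun m' m =>
    if m' = m then a.1 (p.rowAt m)
    else if m'.val = m.val + 1 ∧ p.IsDown m then a.2 (p.rowAt m)
    else 0

/-- The right action on the basis `x_0, …, x_l`: `x_m ε_j = x_m` if `x_m` lies in column `j`,
and `x_{m+1} α_j = x_m` if `x_m` lies in column `j` and the `m`-th step goes to the right;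
everything else is zero. The entry at `(m, m')` is the coefficient of `x_m` in `x_{m'} a`. -/
def rightMatrix (a : NakayamaAlgebra k n) : Matrix (Fin (p.length + 1)) (Fin (p.length + 1)) k :=
  Matrix.of fun m m' =>
    if m = m' then a.1 (p.colAt m)
    else if m'.val = m.val + 1 ∧ ¬ p.IsDown m then a.2 (p.colAt m)
    else 0

theorem leftMatrix_mul (a b : NakayamaAlgebra k n) :
    p.leftMatrix k (a * b) = p.leftMatrix k a * p.leftMatrix k b := by
  ext i j
  have key : ∀ x, p.leftMatrix k a i x * p.leftMatrix k b x j =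
      (if x = j then p.leftMatrix k a i j * b.1 (p.rowAt j) else 0) +
      (if x = i then (if i = j then 0 else a.1 (p.rowAt i) * p.leftMatrix k b i j) else 0) := by
    intro x
    by_cases hxj : x = j
    · subst hxj
      by_cases hi : i = x
      · subst hi; simp [leftMatrix]
      · simp [leftMatrix, Ne.symm hi]
    · by_cases hxi : x = i
      · subst hxi
        simp [leftMatrix, hxj]
      · have : ¬ ((i.val = x.val + 1 ∧ p.IsDown x) ∧ (x.val = j.val + 1 ∧ p.IsDown j)) := by
          rintro ⟨⟨_, h1⟩, h2, h3⟩
          rw [h2, isDown_succ] at h1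
          exact h1 h3
        by_cases h1 : i.val = x.val + 1 ∧ p.IsDown x
        · have h2 : ¬ (x.val = j.val + 1 ∧ p.IsDown j) := fun h => this ⟨h1, h⟩
          simp [leftMatrix, hxj, hxi, h2]
        · simp [leftMatrix, hxj, hxi, Ne.symm hxi, h1]
  rw [Matrix.mul_apply, Finset.sum_congr rfl fun x _ => key x, Finset.sum_add_distrib]
  by_cases hij : i = j
  · subst hij; simp [leftMatrix]
  · by_cases h : i.val = j.val + 1 ∧ p.IsDown j
    · have := p.rowAt_succ h.2
      rw [← h.1] at this
      simp [leftMatrix, hij, h.2, h.1]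
      rw [← h.1, this]; ring
    · simp [leftMatrix, hij, h]

theorem rightMatrix_mul (a b : NakayamaAlgebra k n) :
    p.rightMatrix k (a * b) = p.rightMatrix k b * p.rightMatrix k a := by
  ext i j
  have key : ∀ x, p.rightMatrix k b i x * p.rightMatrix k a x j =
      (if x = j then p.rightMatrix k b i j * a.1 (p.colAt j) else 0) +
      (if x = i then (if i = j then 0 else b.1 (p.colAt i) * p.rightMatrix k a i j) else 0) := by
    intro x
    by_cases hxj : x = j
    · subst hxj
      by_cases hi : i = x
      · subst hi; simp [rightMatrix]
      · simp [rightMatrix, Ne.symm hi]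
    · by_cases hxi : x = i
      · subst hxi
        simp [rightMatrix, hxj]
      · have : ¬ ((x.val = i.val + 1 ∧ ¬ p.IsDown i) ∧ (j.val = x.val + 1 ∧ ¬ p.IsDown x)) := by
          rintro ⟨⟨h2, h3⟩, _, h1⟩
          rw [h2, isDown_succ] at h1
          exact h1 h3
        by_cases h1 : x.val = i.val + 1 ∧ ¬ p.IsDown i
        · have h2 : ¬ (j.val = x.val + 1 ∧ ¬ p.IsDown x) := fun h => this ⟨h1, h⟩
          simp [rightMatrix, hxj, hxi, h2]
        · simp [rightMatrix, hxj, hxi, Ne.symm hxi, h1]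
  rw [Matrix.mul_apply, Finset.sum_congr rfl fun x _ => key x, Finset.sum_add_distrib]
  by_cases hij : i = j
  · subst hij; simp [rightMatrix, mul_comm]
  · by_cases h : j.val = i.val + 1 ∧ ¬ p.IsDown i
    · have := p.colAt_succ h.2
      rw [← h.1] at this
      simp [rightMatrix, hij, h.2, h.1]
      rw [← h.1, this]; ring
    · simp [rightMatrix, hij, h]

theorem leftMatrix_mul_rightMatrix (a b : NakayamaAlgebra k n) :
    p.leftMatrix k a * p.rightMatrix k b = p.rightMatrix k b * p.leftMatrix k a := by
  ext i j
  have key₁ : ∀ x, p.leftMatrix k a i x * p.rightMatrix k b x j =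
      (if x = j then p.leftMatrix k a i j * b.1 (p.colAt j) else 0) +
      (if x = i then (if i = j then 0 else a.1 (p.rowAt i) * p.rightMatrix k b i j) else 0) := by
    intro x
    by_cases hxj : x = j
    · subst hxj
      by_cases hi : i = x
      · subst hi; simp [leftMatrix, rightMatrix]
      · simp [leftMatrix, rightMatrix, Ne.symm hi]
    · by_cases hxi : x = i
      · subst hxi
        simp [leftMatrix, rightMatrix, hxj]
      · by_cases h : p.IsDown x <;> simp [leftMatrix, rightMatrix, hxj, hxi, Ne.symm hxi, h]
  have key₂ : ∀ x, p.rightMatrix k b i x * p.leftMatrix k a x j =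
      (if x = j then p.rightMatrix k b i j * a.1 (p.rowAt j) else 0) +
      (if x = i then (if i = j then 0 else b.1 (p.colAt i) * p.leftMatrix k a i j) else 0) := by
    intro x
    by_cases hxj : x = j
    · subst hxj
      by_cases hi : i = x
      · subst hi; simp [leftMatrix, rightMatrix]
      · simp [leftMatrix, rightMatrix, Ne.symm hi]
    · by_cases hxi : x = i
      · subst hxi
        simp [leftMatrix, rightMatrix, hxj]
      · have : ¬ ((x.val = i.val + 1 ∧ ¬ p.IsDown i) ∧ (x.val = j.val + 1 ∧ p.IsDown j)) := by
          rintro ⟨⟨h2, h3⟩, h4, h1⟩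
          exact h3 ((show i.val = j.val by omega) ▸ h1)
        by_cases h1 : x.val = i.val + 1 ∧ ¬ p.IsDown i
        · have h2 : ¬ (x.val = j.val + 1 ∧ p.IsDown j) := fun h => this ⟨h1, h⟩
          simp [leftMatrix, rightMatrix, hxj, hxi, h2]
        · simp [leftMatrix, rightMatrix, hxj, hxi, Ne.symm hxi, h1]
  rw [Matrix.mul_apply, Matrix.mul_apply, Finset.sum_congr rfl fun x _ => key₁ x,
    Finset.sum_congr rfl fun x _ => key₂ x, Finset.sum_add_distrib, Finset.sum_add_distrib]
  by_cases hij : i = j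
  · subst hij; simp [leftMatrix, rightMatrix, mul_comm]
  · have hL : p.leftMatrix k a i j * b.1 (p.colAt j) = b.1 (p.colAt i) * p.leftMatrix k a i j := by
      by_cases h : i.val = j.val + 1 ∧ p.IsDown j
      · rw [h.1, colAt_succ_of_isDown p h.2, mul_comm]
      · simp [leftMatrix, hij, h]
    have hR : a.1 (p.rowAt i) * p.rightMatrix k b i j =
        p.rightMatrix k b i j * a.1 (p.rowAt j) := by
      by_cases h : j.val = i.val + 1 ∧ ¬ p.IsDown i
      · rw [h.1, rowAt_succ_of_not_isDown p h.2, mul_comm]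
      · simp [rightMatrix, hij, h]
    simp only [Finset.sum_ite_eq', Finset.mem_univ, if_true, if_neg hij, hL, hR, add_comm]

/-- The string bimodule with the given data: the push-down along `ℤ² → (ℤ/n)²` of the
representation of the covering quiver that has a copy of `k` (with basis vector `x_m`) at the `m`-th
vertex of the walk for `m = 0, …, l`, the identity at each arrow of the walk, and zero elsewhere. -/
def bimodule : Bimodule k (NakayamaAlgebra k n) where
  carrier := Fin (p.length + 1) → k
  left := Matrix.toLinAlgEquiv'.toAlgHom.comp (AlgHom.ofLinearMap
    { toFun := fun a => p.leftMatrix k a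
      map_add' := fun a b => by
        ext; simp only [leftMatrix, Matrix.of_apply, Matrix.add_apply]; split_ifs <;> simp
      map_smul' := fun c a => by
        ext; simp only [leftMatrix, Matrix.of_apply, Matrix.smul_apply]; split_ifs <;> simp }
    (by ext; simp [leftMatrix, Matrix.one_apply]) (p.leftMatrix_mul k))
  right := Matrix.toLinAlgEquiv'.toAlgHom.comp (AlgHom.ofLinearMap
    { toFun := fun a => p.rightMatrix k a.unop
      map_add' := fun a b => by
        ext; simp only [rightMatrix, Matrix.of_apply, Matrix.add_apply]; split_ifs <;> simp
      map_smul' := fun c a => by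
        ext; simp only [rightMatrix, Matrix.of_apply, Matrix.smul_apply]; split_ifs <;> simp }
    (by ext; simp [rightMatrix, Matrix.one_apply]) (fun a b => p.rightMatrix_mul k b.unop a.unop))
  left_right := fun a b x => by
    have h := p.leftMatrix_mul_rightMatrix k a b.unop
    simpa [Matrix.mulVec_mulVec] using congrArg (fun M => M.mulVec x) h

end StringDatum

/-- A string bimodule. -/
def Bimodule.IsString {k : Type u} [Field k] {n : ℕ} (X : Bimodule k (NakayamaAlgebra k n)) :
    Prop :=
  ∃ r : StringDatum n, Nonempty (Bimodule.Iso X (r.bimodule k))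

/-! Everything is computed on bases that the arrows permute up to zero (`MonomialBasis`). A string
bimodule is an interval of one infinite zigzag walk: from an odd position `a` the left arrow leads
to `a + 1` and the right arrow to `a - 1`; even positions are killed by both.

Let `X` have basis `x_a` with `s ≤ a ≤ e`, and `Y` basis `y_b` with `s₂ ≤ b ≤ e₂`. In `X ⊗_A Y` the
product `x_a ⊗ y_b` vanishes unless the column of `x_a` is the row of `y_b` modulo `n`. If `a` is
even and `a < e`, then `x_a = x_{a+1} α`, and `α` moves across the tensor sign; if `b` is even and
`s₂ < b`, then `y_b = α y_{b-1}`, and `α` moves the other way. The surviving products are those of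
`IsTensorVertex`, and `zigzagTensor` shows that they form a monomial basis.

Both actions preserve the difference of the column of `x_a` and the row of `y_b`, now taken in `ℤ`,
so the product splits along these diagonals. If a diagonal contains a vertex with both coordinates
even, this vertex is `(e, s₂)`, and the diagonal is the product of an interval inside `{e - 1, e}`
and one inside `{s₂, s₂ + 1}`: the summand is split (`tensorFiber.isKSplit`). Otherwise the diagonal
is empty, giving a zero and hence split summand, or an interval of a zigzag, giving a string
(`tensorFiber.isString`).

For the bounds, height, width and number of valleys of a string bimodule `W` are `dim (rad W) + 1`,
`dim (W rad) + 1` and `dim (rad W ∩ W rad)`. These are isomorphism invariants, so they may be read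
off from the basis of the diagonal, whichever string the summand is identified with. A split summand
may also be a string, but never when it is a full square, by a dimension count (`not_square`). In
all other cases the relevant basis vectors inject into those of `X` and of `Y`. -/

namespace NakayamaAlgebra

variable {k : Type u} [Field k] {n : ℕ}

/-- The idempotent of the vertex `i`. -/
def vertex (i : ZMod n) : NakayamaAlgebra k n := (Pi.single i 1, fun _ => 0)

/-- The arrow starting at the vertex `i`. -/
def arrow (i : ZMod n) : NakayamaAlgebra k n := (fun _ => 0, Pi.single i 1)

@[simp] theorem vertex_fst_self (i : ZMod n) : (vertex i : NakayamaAlgebra k n).1 i = 1 :=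
  Pi.single_eq_same i 1

theorem vertex_fst_of_ne {i j : ZMod n} (h : j ≠ i) : (vertex i : NakayamaAlgebra k n).1 j = 0 :=
  Pi.single_eq_of_ne h 1

@[simp] theorem vertex_snd (i j : ZMod n) : (vertex i : NakayamaAlgebra k n).2 j = 0 := rfl

@[simp] theorem arrow_fst (i j : ZMod n) : (arrow i : NakayamaAlgebra k n).1 j = 0 := rfl

@[simp] theorem arrow_snd_self (i : ZMod n) : (arrow i : NakayamaAlgebra k n).2 i = 1 :=
  Pi.single_eq_same i 1

end NakayamaAlgebra

/-! ### Bimodules with a basis permuted up to zero by the arrows -/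

/-- Combinatorial data of a bimodule over `Q_n` with a basis that is permuted up to zero by the
arrows: `L` is the left and `R` is the right action of the arrows. -/
structure MonomialDatum (n : ℕ) where
  S : Type
  [finite : Finite S]
  row : S → ZMod n
  col : S → ZMod n
  L : S → Option S
  R : S → Option S
  L_row : ∀ {s t}, t ∈ L s → row t = row s + 1
  L_col : ∀ {s t}, t ∈ L s → col t = col s
  L_L : ∀ {s t}, t ∈ L s → L t = none
  L_inj : ∀ {s s₂ t}, t ∈ L s → t ∈ L s₂ → s = s₂
  R_row : ∀ {s t}, t ∈ R s → row t = row s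
  R_col : ∀ {s t}, t ∈ R s → col s = col t + 1
  R_R : ∀ {s t}, t ∈ R s → R t = none
  R_inj : ∀ {s s₂ t}, t ∈ R s → t ∈ R s₂ → s = s₂
  comm : ∀ s, (L s).bind R = (R s).bind L

namespace MonomialDatum

variable {k : Type u} [Field k] {n : ℕ} (D : MonomialDatum n)

attribute [instance] MonomialDatum.finite

/-- The image of a family under the left action. -/
def leftVec {V : Type*} [AddCommGroup V] [Module k V] (b : D.S → V) (a : NakayamaAlgebra k n)
    (s : D.S) : V :=
  a.1 (D.row s) • b s + (D.L s).elim 0 fun t => a.2 (D.row s) • b t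

/-- The image of a family under the right action. -/
def rightVec {V : Type*} [AddCommGroup V] [Module k V] (b : D.S → V) (a : NakayamaAlgebra k n)
    (s : D.S) : V :=
  -- The arrow that takes `s` to `t` from the right starts at the column of `t`, one below that of
  -- `s`; hence the index `D.col t`, whereas the left action reads its coefficient at `s`.
  a.1 (D.col s) • b s + (D.R s).elim 0 fun t => a.2 (D.col t) • b t

theorem map_leftVec {V W : Type*} [AddCommGroup V] [Module k V] [AddCommGroup W] [Module k W]
    (f : V →ₗ[k] W) (b : D.S → V) (a : NakayamaAlgebra k n) (s : D.S) :
    f (D.leftVec b a s) = D.leftVec (fun t => f (b t)) a s := by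
  cases h : D.L s <;> simp [leftVec, h]

theorem map_rightVec {V W : Type*} [AddCommGroup V] [Module k V] [AddCommGroup W] [Module k W]
    (f : V →ₗ[k] W) (b : D.S → V) (a : NakayamaAlgebra k n) (s : D.S) :
    f (D.rightVec b a s) = D.rightVec (fun t => f (b t)) a s := by
  cases h : D.R s <;> simp [rightVec, h]

section

variable {V : Type*} [AddCommGroup V] [Module k V] (b : D.S → V)

theorem leftVec_of_some {s t : D.S} (h : D.L s = some t) (a : NakayamaAlgebra k n) :
    D.leftVec b a s = a.1 (D.row s) • b s + a.2 (D.row s) • b t := by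
  rw [leftVec, h, Option.elim_some]

theorem leftVec_of_none {s : D.S} (h : D.L s = none) (a : NakayamaAlgebra k n) :
    D.leftVec b a s = a.1 (D.row s) • b s := by
  rw [leftVec, h, Option.elim_none, add_zero]

theorem rightVec_of_some {s t : D.S} (h : D.R s = some t) (a : NakayamaAlgebra k n) :
    D.rightVec b a s = a.1 (D.col s) • b s + a.2 (D.col t) • b t := by
  rw [rightVec, h, Option.elim_some]

theorem rightVec_of_none {s : D.S} (h : D.R s = none) (a : NakayamaAlgebra k n) :
    D.rightVec b a s = a.1 (D.col s) • b s := by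
  rw [rightVec, h, Option.elim_none, add_zero]

theorem leftVec_congr {D' : MonomialDatum n} (φ : D.S → D'.S) (b' : D'.S → V)
    (a : NakayamaAlgebra k n) (s : D.S) (hrow : D'.row (φ s) = D.row s)
    (hL : D'.L (φ s) = (D.L s).map φ) (hb : b' (φ s) = b s) (hb' : ∀ t ∈ D.L s, b' (φ t) = b t) :
    D'.leftVec b' a (φ s) = D.leftVec b a s := by
  rw [leftVec, leftVec, hrow, hL, hb]
  cases h : D.L s with
  | none => rfl
  | some t => simp [hb' t h]

theorem rightVec_congr {D' : MonomialDatum n} (φ : D.S → D'.S) (b' : D'.S → V)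
    (a : NakayamaAlgebra k n) (s : D.S) (hcol : ∀ s, D'.col (φ s) = D.col s)
    (hR : D'.R (φ s) = (D.R s).map φ) (hb : b' (φ s) = b s) (hb' : ∀ t ∈ D.R s, b' (φ t) = b t) :
    D'.rightVec b' a (φ s) = D.rightVec b a s := by
  rw [rightVec, rightVec, hcol, hR, hb]
  cases h : D.R s with
  | none => rfl
  | some t => simp [hb' t h, hcol]

theorem leftVec_add (x y : NakayamaAlgebra k n) (s : D.S) :
    D.leftVec b (x + y) s = D.leftVec b x s + D.leftVec b y s := by
  cases h : D.L s <;> simp [leftVec, h, add_smul]; abel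

theorem leftVec_smul (c : k) (x : NakayamaAlgebra k n) (s : D.S) :
    D.leftVec b (c • x) s = c • D.leftVec b x s := by
  cases h : D.L s <;> simp [leftVec, h, mul_smul]

theorem leftVec_one (s : D.S) : D.leftVec b (1 : NakayamaAlgebra k n) s = b s := by
  cases h : D.L s <;> simp [leftVec, h]

/-- Since `y` acts first, the action of `x` sits in the inner family. The term with two arrows is
absent by `L_L`, which encodes that paths of length two vanish. -/
theorem leftVec_mul (x y : NakayamaAlgebra k n) (s : D.S) :
    D.leftVec b (x * y) s = D.leftVec (D.leftVec b x) y s := by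
  cases h : D.L s with
  | none => simp [leftVec, h, smul_smul, mul_comm]
  | some t =>
    simp only [leftVec, h, Option.elim_some, NakayamaAlgebra.mul_fst, NakayamaAlgebra.mul_snd,
      D.L_row h, D.L_L h, Option.elim_none]
    module

theorem rightVec_add (x y : NakayamaAlgebra k n) (s : D.S) :
    D.rightVec b (x + y) s = D.rightVec b x s + D.rightVec b y s := by
  cases h : D.R s <;> simp [rightVec, h, add_smul]; abel

theorem rightVec_smul (c : k) (x : NakayamaAlgebra k n) (s : D.S) :
    D.rightVec b (c • x) s = c • D.rightVec b x s := by
  cases h : D.R s <;> simp [rightVec, h, mul_smul]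

theorem rightVec_one (s : D.S) : D.rightVec b (1 : NakayamaAlgebra k n) s = b s := by
  cases h : D.R s <;> simp [rightVec, h]

theorem rightVec_mul (x y : NakayamaAlgebra k n) (s : D.S) :
    D.rightVec b (x * y) s = D.rightVec (D.rightVec b y) x s := by
  cases h : D.R s with
  | none => simp [rightVec, h, smul_smul]
  | some t =>
    simp only [rightVec, h, Option.elim_some, NakayamaAlgebra.mul_fst, NakayamaAlgebra.mul_snd,
      D.R_col h, D.R_R h, Option.elim_none]
    module

theorem leftVec_rightVec (x y : NakayamaAlgebra k n) (s : D.S) :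
    D.rightVec (D.leftVec b x) y s = D.leftVec (D.rightVec b y) x s := by
  have hc := D.comm s
  cases hL : D.L s with
  | none =>
    cases hR : D.R s with
    | none => simp [leftVec, rightVec, hL, hR, smul_smul, mul_comm]
    | some t =>
      have ht : D.L t = none := by simpa [hL, hR] using hc.symm
      simp [leftVec, rightVec, hL, hR, ht, smul_smul, mul_comm, D.R_row hR]
  | some r =>
    cases hR : D.R s with
    | none =>
      have hr : D.R r = none := by simpa [hL, hR] using hc
      simp [leftVec, rightVec, hL, hR, hr, smul_smul, mul_comm, D.L_col hL]
    | some t =>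
      have hrt : D.R r = D.L t := by simpa [hL, hR] using hc
      cases h : D.L t with
      | none =>
        simp only [leftVec, rightVec, hL, hR, h, hrt, Option.elim_some, Option.elim_none,
          D.L_col hL, D.R_row hR]
        module
      | some z =>
        simp only [leftVec, rightVec, hL, hR, h, hrt, Option.elim_some, D.L_col hL, D.R_row hR,
          D.L_col h]
        module

end

/-- The bimodule with basis `D.S`. -/
noncomputable def bimodule (k : Type u) [Field k] : Bimodule k (NakayamaAlgebra k n) where
  carrier := D.S →₀ k
  left := AlgHom.ofLinearMap
    { toFun := fun a => Finsupp.linearCombination k (D.leftVec (fun s => Finsupp.single s 1) a)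
      map_add' := fun a b => by ext s : 2; simp [leftVec_add]
      map_smul' := fun c a => by ext s : 2; simp [leftVec_smul] }
    (by ext s : 2; simp [leftVec_one])
    (fun a b => by
      ext s : 2
      simp only [LinearMap.coe_mk, AddHom.coe_mk, LinearMap.comp_apply, Module.End.mul_apply,
        Finsupp.lsingle_apply, Finsupp.linearCombination_single, one_smul, map_leftVec,
        leftVec_mul])
  right := AlgHom.ofLinearMap
    { toFun := fun a =>
        Finsupp.linearCombination k (D.rightVec (fun s => Finsupp.single s 1) a.unop)
      map_add' := fun a b => by ext s : 2; simp [rightVec_add]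
      map_smul' := fun c a => by ext s : 2; simp [rightVec_smul] }
    (by ext s : 2; simp [rightVec_one])
    (fun a b => by
      ext s : 2
      simp only [LinearMap.coe_mk, AddHom.coe_mk, LinearMap.comp_apply, Module.End.mul_apply,
        Finsupp.lsingle_apply, Finsupp.linearCombination_single, one_smul, map_rightVec,
        rightVec_mul, MulOpposite.unop_mul])
  left_right := fun a b x => by
    induction x using Finsupp.induction_linear with
    | zero => simp
    | add x y hx hy => simp only [map_add, hx, hy]
    | single s c =>
      rw [← mul_one c, ← smul_eq_mul, ← Finsupp.smul_single]
      simp only [map_smul]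
      congr 1
      simp only [AlgHom.ofLinearMap_apply, LinearMap.coe_mk, AddHom.coe_mk,
        Finsupp.linearCombination_single, one_smul, map_rightVec, map_leftVec, leftVec_rightVec]

end MonomialDatum

/-- A basis of a bimodule on which the vertices and arrows act as prescribed by `D`. -/
structure MonomialBasis {k : Type u} [Field k] {n : ℕ} (W : Bimodule k (NakayamaAlgebra k n))
    (D : MonomialDatum n) where
  basis : Module.Basis D.S k W.carrier
  left_basis : ∀ a s, W.left a (basis s) = D.leftVec basis a s
  right_basis : ∀ a s, W.right (MulOpposite.op a) (basis s) = D.rightVec basis a s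

namespace MonomialBasis

variable {k : Type u} [Field k] {n : ℕ} {W W' : Bimodule k (NakayamaAlgebra k n)}
  {D D' : MonomialDatum n}

/-- The standard basis of the monomial bimodule. -/
noncomputable def standard (D : MonomialDatum n) : MonomialBasis (D.bimodule k) D where
  basis := .ofRepr (LinearEquiv.refl k (D.S →₀ k))
  left_basis _ s := (Finsupp.linearCombination_single (M := D.S →₀ k) k 1 s).trans
    (one_smul k (_ : D.S →₀ k))
  right_basis _ s := (Finsupp.linearCombination_single (M := D.S →₀ k) k 1 s).trans
    (one_smul k (_ : D.S →₀ k))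

/-- Bimodules with the same monomial datum are isomorphic. -/
noncomputable def iso (B : MonomialBasis W D) (B' : MonomialBasis W' D) : Bimodule.Iso W W' where
  toEquiv := B.basis.equiv B'.basis (Equiv.refl _)
  map_left a x := by
    have : (B.basis.equiv B'.basis (Equiv.refl _)).toLinearMap ∘ₗ W.left a =
        W'.left a ∘ₗ (B.basis.equiv B'.basis (Equiv.refl _)).toLinearMap :=
      B.basis.ext fun s => by
        simp only [LinearMap.comp_apply, B.left_basis, D.map_leftVec]
        simp [B'.left_basis]
    exact LinearMap.congr_fun this x
  map_right a x := by
    have : (B.basis.equiv B'.basis (Equiv.refl _)).toLinearMap ∘ₗ W.right a =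
        W'.right a ∘ₗ (B.basis.equiv B'.basis (Equiv.refl _)).toLinearMap :=
      B.basis.ext fun s => by
        induction a using MulOpposite.rec' with
        | h a =>
        simp only [LinearMap.comp_apply, B.right_basis, D.map_rightVec]
        simp [B'.right_basis]
    exact LinearMap.congr_fun this x

/-- Transport of a monomial basis along an isomorphism. -/
noncomputable def ofIso (B : MonomialBasis W D) (e : Bimodule.Iso W W') : MonomialBasis W' D where
  basis := B.basis.map e.toEquiv
  left_basis a s := by
    have : ⇑(B.basis.map e.toEquiv) = fun s => e.toEquiv.toLinearMap (B.basis s) := by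
      ext s : 1; simp
    rw [this, ← D.map_leftVec, ← B.left_basis]
    exact (e.map_left _ _).symm
  right_basis a s := by
    have : ⇑(B.basis.map e.toEquiv) = fun s => e.toEquiv.toLinearMap (B.basis s) := by
      ext s : 1; simp
    rw [this, ← D.map_rightVec, ← B.right_basis]
    exact (e.map_right _ _).symm

/-- Transport of a monomial basis along an isomorphism of data. -/
noncomputable def reindex (B : MonomialBasis W D) (φ : D.S ≃ D'.S)
    (hrow : ∀ s, D'.row (φ s) = D.row s) (hcol : ∀ s, D'.col (φ s) = D.col s)
    (hL : ∀ s t, φ t ∈ D'.L (φ s) ↔ t ∈ D.L s) (hR : ∀ s t, φ t ∈ D'.R (φ s) ↔ t ∈ D.R s) :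
    MonomialBasis W D' where
  basis := B.basis.reindex φ
  left_basis a s := by
    obtain ⟨s, rfl⟩ := φ.surjective s
    have : D'.L (φ s) = (D.L s).map φ := by
      ext t
      obtain ⟨t, rfl⟩ := φ.surjective t
      simpa using hL s t
    rw [Module.Basis.reindex_apply, Equiv.symm_apply_apply, B.left_basis]
    exact (D.leftVec_congr _ φ _ a s (hrow s) this (by simp) fun t _ => by simp).symm
  right_basis a s := by
    obtain ⟨s, rfl⟩ := φ.surjective s
    have : D'.R (φ s) = (D.R s).map φ := by
      ext t
      obtain ⟨t, rfl⟩ := φ.surjective t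
      simpa using hR s t
    rw [Module.Basis.reindex_apply, Equiv.symm_apply_apply, B.right_basis]
    exact (D.rightVec_congr _ φ _ a s hcol this (by simp) fun t _ => by simp).symm

end MonomialBasis

/-! ### Direct sum decomposition along an invariant function -/

namespace MonomialDatum

variable {n : ℕ} (D : MonomialDatum n)

/-- The part of a monomial datum where an invariant function `f` takes the value `i`. -/
noncomputable def fiber {ι : Type*} (f : D.S → ι) (hL : ∀ {s t}, t ∈ D.L s → f t = f s)
    (hR : ∀ {s t}, t ∈ D.R s → f t = f s) (i : ι) : MonomialDatum n where
  S := {s // f s = i}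
  row s := D.row s
  col s := D.col s
  L s := (D.L s).pmap Subtype.mk fun _ h => (hL h).trans s.2
  R s := (D.R s).pmap Subtype.mk fun _ h => (hR h).trans s.2
  L_row := by
    rintro s ⟨t, ht⟩ h
    simp only [Option.mem_def, Option.pmap_eq_some_iff] at h
    obtain ⟨_, _, h, he⟩ := h
    cases he
    exact D.L_row h
  L_col := by
    rintro s ⟨t, ht⟩ h
    simp only [Option.mem_def, Option.pmap_eq_some_iff] at h
    obtain ⟨_, _, h, he⟩ := h
    cases he
    exact D.L_col h
  L_L := by
    rintro s ⟨t, ht⟩ h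
    simp only [Option.mem_def, Option.pmap_eq_some_iff] at h
    obtain ⟨_, _, h, he⟩ := h
    cases he
    simpa using D.L_L h
  L_inj := by
    rintro ⟨s, hs⟩ ⟨s₂, hs'⟩ ⟨t, ht⟩ h h'
    simp only [Option.mem_def, Option.pmap_eq_some_iff] at h h'
    obtain ⟨_, _, h, he⟩ := h
    obtain ⟨_, _, h', he'⟩ := h'
    cases he
    cases he'
    exact Subtype.ext (D.L_inj h h')
  R_row := by
    rintro s ⟨t, ht⟩ h
    simp only [Option.mem_def, Option.pmap_eq_some_iff] at h
    obtain ⟨_, _, h, he⟩ := h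
    cases he
    exact D.R_row h
  R_col := by
    rintro s ⟨t, ht⟩ h
    simp only [Option.mem_def, Option.pmap_eq_some_iff] at h
    obtain ⟨_, _, h, he⟩ := h
    cases he
    exact D.R_col h
  R_R := by
    rintro s ⟨t, ht⟩ h
    simp only [Option.mem_def, Option.pmap_eq_some_iff] at h
    obtain ⟨_, _, h, he⟩ := h
    cases he
    simpa using D.R_R h
  R_inj := by
    rintro ⟨s, hs⟩ ⟨s₂, hs'⟩ ⟨t, ht⟩ h h'
    simp only [Option.mem_def, Option.pmap_eq_some_iff] at h h'
    obtain ⟨_, _, h, he⟩ := h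
    obtain ⟨_, _, h', he'⟩ := h'
    cases he
    cases he'
    exact Subtype.ext (D.R_inj h h')
  comm s := by
    ext ⟨t, ht⟩
    have h := congrArg (fun o => t ∈ o) (D.comm s)
    simp only [Option.mem_def, Option.bind_eq_some_iff, eq_iff_iff] at h
    simp only [Option.bind_eq_some_iff, Option.pmap_eq_some_iff, Subtype.mk.injEq]
    constructor
    · rintro ⟨_, ⟨r, hr, hr', rfl⟩, _, _, h2, rfl⟩
      obtain ⟨z, hz, hz'⟩ := h.1 ⟨r, hr', h2⟩
      exact ⟨⟨z, (hR hz).trans s.2⟩, ⟨z, _, hz, rfl⟩, _, ht, hz', rfl⟩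
    · rintro ⟨_, ⟨r, hr, hr', rfl⟩, _, _, h2, rfl⟩
      obtain ⟨z, hz, hz'⟩ := h.2 ⟨r, hr', h2⟩
      exact ⟨⟨z, (hL hz).trans s.2⟩, ⟨z, _, hz, rfl⟩, _, ht, hz', rfl⟩

variable {ι : Type*} (f : D.S → ι) (hL : ∀ {s t}, t ∈ D.L s → f t = f s)
  (hR : ∀ {s t}, t ∈ D.R s → f t = f s) (i : ι)

theorem mem_fiber_L (s t : (D.fiber f hL hR i).S) :
    t ∈ (D.fiber f hL hR i).L s ↔ t.1 ∈ D.L s.1 := by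
  obtain ⟨t, ht⟩ := t
  refine Option.pmap_eq_some_iff.trans ?_
  exact ⟨by rintro ⟨_, _, h, he⟩; cases he; exact h, fun h => ⟨t, ht, h, rfl⟩⟩

theorem mem_fiber_R (s t : (D.fiber f hL hR i).S) :
    t ∈ (D.fiber f hL hR i).R s ↔ t.1 ∈ D.R s.1 := by
  obtain ⟨t, ht⟩ := t
  refine Option.pmap_eq_some_iff.trans ?_
  exact ⟨by rintro ⟨_, _, h, he⟩; cases he; exact h, fun h => ⟨t, ht, h, rfl⟩⟩

/-- A monomial datum is the disjoint union of the fibers of an invariant function. -/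
def fiberEquiv : (Σ i, (D.fiber f hL hR i).S) ≃ D.S := Equiv.sigmaFiberEquiv f

theorem map_fiber_L (s : (D.fiber f hL hR i).S) :
    ((D.fiber f hL hR i).L s).map (fun t => D.fiberEquiv f hL hR ⟨i, t⟩) =
      D.L (D.fiberEquiv f hL hR ⟨i, s⟩) := by
  ext t
  simp only [Option.map_eq_some_iff]
  constructor
  · rintro ⟨t, h, rfl⟩
    exact (D.mem_fiber_L f hL hR i s t).1 h
  · intro h
    exact ⟨⟨t, (hL h).trans s.2⟩, (D.mem_fiber_L f hL hR i s ⟨t, _⟩).2 h, rfl⟩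

theorem map_fiber_R (s : (D.fiber f hL hR i).S) :
    ((D.fiber f hL hR i).R s).map (fun t => D.fiberEquiv f hL hR ⟨i, t⟩) =
      D.R (D.fiberEquiv f hL hR ⟨i, s⟩) := by
  ext t
  simp only [Option.map_eq_some_iff]
  constructor
  · rintro ⟨t, h, rfl⟩
    exact (D.mem_fiber_R f hL hR i s t).1 h
  · intro h
    exact ⟨⟨t, (hR h).trans s.2⟩, (D.mem_fiber_R f hL hR i s ⟨t, _⟩).2 h, rfl⟩

end MonomialDatum

namespace Bimodule

variable {k A : Type u} [Field k] [Ring A] [Algebra k A] {m : ℕ} (Z : Fin m → Bimodule k A)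

/-- The inclusion of a summand into a direct sum. -/
def inclusion (i : Fin m) : (Z i).carrier →ₗ[k] (directSum Z).carrier :=
  LinearMap.single k (fun i => (Z i).carrier) i

theorem left_inclusion (i : Fin m) (a : A) (x : (Z i).carrier) :
    (directSum Z).left a (inclusion Z i x) = inclusion Z i ((Z i).left a x) := by
  funext j
  change (Z j).left a (Pi.single (M := fun i => (Z i).carrier) i x j) =
    Pi.single (M := fun i => (Z i).carrier) i ((Z i).left a x) j
  by_cases h : j = i
  · subst h; simp
  · simp [h]

theorem right_inclusion (i : Fin m) (a : Aᵐᵒᵖ) (x : (Z i).carrier) :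
    (directSum Z).right a (inclusion Z i x) = inclusion Z i ((Z i).right a x) := by
  funext j
  change (Z j).right a (Pi.single (M := fun i => (Z i).carrier) i x j) =
    Pi.single (M := fun i => (Z i).carrier) i ((Z i).right a x) j
  by_cases h : j = i
  · subst h; simp
  · simp [h]

/-- The basis of a direct sum obtained from bases of the summands. -/
noncomputable def directSumBasis {ι : Fin m → Type} (b : ∀ i, Module.Basis (ι i) k (Z i).carrier) :
    Module.Basis (Σ i, ι i) k (directSum Z).carrier :=
  Pi.basis b

theorem directSumBasis_apply {ι : Fin m → Type} (b : ∀ i, Module.Basis (ι i) k (Z i).carrier)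
    (i : Fin m) (s : ι i) : directSumBasis Z b ⟨i, s⟩ = inclusion Z i (b i s) :=
  Pi.basis_apply b ⟨i, s⟩

end Bimodule

namespace MonomialBasis

variable {k : Type u} [Field k] {n : ℕ}

/-- A monomial bimodule is the direct sum of the bimodules of the fibers of an invariant
function. -/
noncomputable def directSumFiber (D : MonomialDatum n) {m : ℕ} (f : D.S → Fin m)
    (hL : ∀ {s t}, t ∈ D.L s → f t = f s) (hR : ∀ {s t}, t ∈ D.R s → f t = f s) :
    MonomialBasis (Bimodule.directSum fun i => (D.fiber f hL hR i).bimodule k) D where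
  basis := (Bimodule.directSumBasis _ fun i => (standard (k := k) (D.fiber f hL hR i)).basis).reindex
    (D.fiberEquiv f hL hR)
  left_basis a s := by
    obtain ⟨⟨i, s⟩, rfl⟩ := (D.fiberEquiv f hL hR).surjective s
    rw [Module.Basis.reindex_apply, Equiv.symm_apply_apply, Bimodule.directSumBasis_apply,
      Bimodule.left_inclusion, (standard _).left_basis, MonomialDatum.map_leftVec,
      MonomialDatum.leftVec, MonomialDatum.leftVec, ← D.map_fiber_L]
    cases (D.fiber f hL hR i).L s <;>
      simp [Bimodule.directSumBasis_apply] <;> rfl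
  right_basis a s := by
    obtain ⟨⟨i, s⟩, rfl⟩ := (D.fiberEquiv f hL hR).surjective s
    rw [Module.Basis.reindex_apply, Equiv.symm_apply_apply, Bimodule.directSumBasis_apply,
      Bimodule.right_inclusion, (standard _).right_basis, MonomialDatum.map_rightVec,
      MonomialDatum.rightVec, MonomialDatum.rightVec, ← D.map_fiber_R]
    cases (D.fiber f hL hR i).R s <;>
      simp [Bimodule.directSumBasis_apply] <;> rfl

end MonomialBasis

/-! ### Invariants -/

namespace Bimodule

variable {k : Type u} [Field k] {n : ℕ} (W : Bimodule k (NakayamaAlgebra k n))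

/-- The product of the radical of `Q_n` with a bimodule. -/
def leftRad : Submodule k W.carrier :=
  Submodule.span k {y | ∃ a : NakayamaAlgebra k n, (∀ i, a.1 i = 0) ∧ ∃ x, y = W.left a x}

/-- The product of a bimodule with the radical of `Q_n`. -/
def rightRad : Submodule k W.carrier :=
  Submodule.span k {y | ∃ a : NakayamaAlgebra k n, (∀ i, a.1 i = 0) ∧
    ∃ x, y = W.right (MulOpposite.op a) x}

end Bimodule

namespace MonomialDatum

variable {n : ℕ} (D : MonomialDatum n)

/-- The image of the left action. -/
def imL : Set D.S := {t | ∃ s, t ∈ D.L s}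

/-- The image of the right action. -/
def imR : Set D.S := {t | ∃ s, t ∈ D.R s}

end MonomialDatum

namespace MonomialBasis

variable {k : Type u} [Field k] {n : ℕ} {W : Bimodule k (NakayamaAlgebra k n)}
  {D D' : MonomialDatum n}

theorem leftRad_eq (B : MonomialBasis W D) : W.leftRad = Submodule.span k (B.basis '' D.imL) := by
  apply le_antisymm
  · refine Submodule.span_le.2 ?_
    rintro _ ⟨a, ha, x, rfl⟩
    have : (⊤ : Submodule k W.carrier) ≤
        (Submodule.span k (B.basis '' D.imL)).comap (W.left a) := by
      rw [← B.basis.span_eq, Submodule.span_le]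
      rintro _ ⟨s, rfl⟩
      simp only [SetLike.mem_coe, Submodule.mem_comap, B.left_basis, MonomialDatum.leftVec, ha,
        zero_smul, zero_add]
      cases h : D.L s with
      | none => simp
      | some t => exact Submodule.smul_mem _ _ (Submodule.subset_span ⟨t, ⟨s, h⟩, rfl⟩)
    exact this trivial
  · refine Submodule.span_le.2 ?_
    rintro _ ⟨t, ⟨s, h⟩, rfl⟩
    refine Submodule.subset_span ⟨NakayamaAlgebra.arrow (D.row s), fun i => rfl, B.basis s, ?_⟩
    rw [Option.mem_def] at h
    simp [B.left_basis, MonomialDatum.leftVec, h]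

theorem rightRad_eq (B : MonomialBasis W D) : W.rightRad = Submodule.span k (B.basis '' D.imR) := by
  apply le_antisymm
  · refine Submodule.span_le.2 ?_
    rintro _ ⟨a, ha, x, rfl⟩
    have : (⊤ : Submodule k W.carrier) ≤
        (Submodule.span k (B.basis '' D.imR)).comap (W.right (MulOpposite.op a)) := by
      rw [← B.basis.span_eq, Submodule.span_le]
      rintro _ ⟨s, rfl⟩
      simp only [SetLike.mem_coe, Submodule.mem_comap, B.right_basis, MonomialDatum.rightVec, ha,
        zero_smul, zero_add]
      cases h : D.R s with
      | none => simp
      | some t => exact Submodule.smul_mem _ _ (Submodule.subset_span ⟨t, ⟨s, h⟩, rfl⟩)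
    exact this trivial
  · refine Submodule.span_le.2 ?_
    rintro _ ⟨t, ⟨s, h⟩, rfl⟩
    refine Submodule.subset_span ⟨NakayamaAlgebra.arrow (D.col t), fun i => rfl, B.basis s, ?_⟩
    rw [Option.mem_def] at h
    simp [B.right_basis, MonomialDatum.rightVec, h]

theorem finrank_span_image (B : MonomialBasis W D) (T : Set D.S) :
    Module.finrank k (Submodule.span k (B.basis '' T)) = T.ncard := by
  classical
  have := Fintype.ofFinite T
  have := finrank_span_eq_card (R := k) (b := fun t : T => B.basis t)
    (B.basis.linearIndependent.comp _ Subtype.val_injective)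
  rw [← Nat.card_coe_set_eq, Nat.card_eq_fintype_card, ← this, ← Set.image_eq_range]

theorem finrank_leftRad (B : MonomialBasis W D) : Module.finrank k W.leftRad = D.imL.ncard := by
  rw [B.leftRad_eq, B.finrank_span_image]

theorem finrank_rightRad (B : MonomialBasis W D) : Module.finrank k W.rightRad = D.imR.ncard := by
  rw [B.rightRad_eq, B.finrank_span_image]

theorem finrank_leftRad_sup_rightRad (B : MonomialBasis W D) :
    Module.finrank k ↥(W.leftRad ⊔ W.rightRad) = (D.imL ∪ D.imR).ncard := by
  rw [B.leftRad_eq, B.rightRad_eq, ← Submodule.span_union, ← Set.image_union,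
    B.finrank_span_image]

theorem natCard_eq (B : MonomialBasis W D) (B' : MonomialBasis W D') :
    Nat.card D.S = Nat.card D'.S := by
  rw [← Module.finrank_eq_nat_card_basis B.basis, ← Module.finrank_eq_nat_card_basis B'.basis]

theorem ncard_imL_eq (B : MonomialBasis W D) (B' : MonomialBasis W D') :
    D.imL.ncard = D'.imL.ncard := by
  rw [← B.finrank_leftRad, ← B'.finrank_leftRad]

theorem ncard_imR_eq (B : MonomialBasis W D) (B' : MonomialBasis W D') :
    D.imR.ncard = D'.imR.ncard := by
  rw [← B.finrank_rightRad, ← B'.finrank_rightRad]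

/-- Inclusion and exclusion: the two radical parts and their sum are spanned by subsets of one
basis, and all three dimensions are invariants of `W`. -/
theorem ncard_imL_inter_imR_eq (B : MonomialBasis W D) (B' : MonomialBasis W D') :
    (D.imL ∩ D.imR).ncard = (D'.imL ∩ D'.imR).ncard := by
  have h1 := Set.ncard_union_add_ncard_inter D.imL D.imR
  have h2 := Set.ncard_union_add_ncard_inter D'.imL D'.imR
  rw [← B.finrank_leftRad_sup_rightRad, ← B.finrank_leftRad, ← B.finrank_rightRad] at h1
  rw [← B'.finrank_leftRad_sup_rightRad, ← B'.finrank_leftRad, ← B'.finrank_rightRad] at h2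
  omega

end MonomialBasis

/-! ### Split bimodules -/

namespace MonomialBasis

variable {k : Type u} [Field k] {n : ℕ} {W : Bimodule k (NakayamaAlgebra k n)}
  {D D₁ D₂ : MonomialDatum n}

/-- A bimodule whose monomial datum is the product of a left and a right datum is split. -/
theorem isKSplit (B : MonomialBasis W D) (φ : D.S ≃ D₁.S × D₂.S)
    (hrow : ∀ s, D.row s = D₁.row (φ s).1) (hcol : ∀ s, D.col s = D₂.col (φ s).2)
    (hL : ∀ s t, t ∈ D.L s ↔ (φ t).1 ∈ D₁.L (φ s).1 ∧ (φ t).2 = (φ s).2)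
    (hR : ∀ s t, t ∈ D.R s ↔ (φ t).2 ∈ D₂.R (φ s).2 ∧ (φ t).1 = (φ s).1) :
    W.IsKSplit := by
  let M := D₁.bimodule k
  let N := D₂.bimodule k
  let bM : MonomialBasis M D₁ := standard D₁
  let bN : MonomialBasis N D₂ := standard D₂
  let _ : Module (NakayamaAlgebra k n) M.carrier := Module.compHom M.carrier M.left.toRingHom
  let _ : Module (NakayamaAlgebra k n)ᵐᵒᵖ N.carrier := Module.compHom N.carrier N.right.toRingHom
  have : IsScalarTower k (NakayamaAlgebra k n) M.carrier :=
    ⟨fun c a x => LinearMap.congr_fun (map_smul M.left c a) x⟩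
  have : IsScalarTower k (NakayamaAlgebra k n)ᵐᵒᵖ N.carrier :=
    ⟨fun c a x => LinearMap.congr_fun (map_smul N.right c a) x⟩
  let O := Bimodule.outer k (NakayamaAlgebra k n) M.carrier N.carrier
  have hOl : ∀ a x y, O.left a (x ⊗ₜ[k] y : M.carrier ⊗[k] N.carrier) =
    (M.left a x ⊗ₜ[k] y : M.carrier ⊗[k] N.carrier) := fun _ _ _ => rfl
  have hOr : ∀ a x y, O.right a (x ⊗ₜ[k] y : M.carrier ⊗[k] N.carrier) =
    (x ⊗ₜ[k] N.right a y : M.carrier ⊗[k] N.carrier) := fun _ _ _ => rfl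
  let b : Module.Basis D.S k (M.carrier ⊗[k] N.carrier) :=
    (bM.basis.tensorProduct bN.basis).reindex φ.symm
  have hb : ∀ s, b s = bM.basis (φ s).1 ⊗ₜ[k] bN.basis (φ s).2 := fun s => by
    simp only [b, Module.Basis.reindex_apply, Equiv.symm_symm]
    exact Module.Basis.tensorProduct_apply' _ _ _
  let BO : MonomialBasis O D :=
    { basis := b
      left_basis := fun a s => by
        have h1 : D₁.L (φ s).1 = (D.L s).map fun t => (φ t).1 := by
          ext x
          rw [Option.map_eq_some_iff]
          constructor
          · intro h
            exact ⟨φ.symm (x, (φ s).2), (hL _ _).2 (by simpa using h), by simp⟩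
          · rintro ⟨t, h, rfl⟩
            exact ((hL _ _).1 h).1
        refine (congrArg (O.left a) (hb s)).trans ((hOl _ _ _).trans ?_)
        rw [bM.left_basis]
        -- Tensoring with a fixed vector of `N` is linear, so it carries the action formula on `M`
        -- to the one on `M ⊗ N`.
        refine (D₁.map_leftVec ((TensorProduct.mk k M.carrier N.carrier).flip
          (bN.basis (φ s).2)) bM.basis a (φ s).1).trans ?_
        refine D.leftVec_congr b (fun t => (φ t).1) _ a s (hrow s).symm h1 (hb s).symm fun t h => ?_
        rw [hb t, ((hL s t).1 h).2]
        rfl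
      right_basis := fun a s => by
        have h1 : D₂.R (φ s).2 = (D.R s).map fun t => (φ t).2 := by
          ext x
          rw [Option.map_eq_some_iff]
          constructor
          · intro h
            exact ⟨φ.symm ((φ s).1, x), (hR _ _).2 (by simpa using h), by simp⟩
          · rintro ⟨t, h, rfl⟩
            exact ((hR _ _).1 h).1
        refine (congrArg (O.right (MulOpposite.op a)) (hb s)).trans ((hOr _ _ _).trans ?_)
        rw [bN.right_basis]
        refine (D₂.map_rightVec (TensorProduct.mk k M.carrier N.carrier
          (bM.basis (φ s).1)) bN.basis a (φ s).2).trans ?_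
        refine D.rightVec_congr b (fun t => (φ t).2) _ a s (fun t => (hcol t).symm) h1
          (hb s).symm fun t h => ?_
        rw [hb t, ((hR s t).1 h).2]
        rfl }
  exact ⟨M.carrier, inferInstance, inferInstance, inferInstance, inferInstance,
    N.carrier, inferInstance, inferInstance, inferInstance, inferInstance,
    Module.Finite.of_basis bM.basis, Module.Finite.of_basis bN.basis, ⟨B.iso BO⟩⟩

end MonomialBasis

/-! ### Intervals of the infinite zigzag walk -/

/-- The datum of the part between `lo` and `hi` of the infinite zigzag walk whose `a`-th vertex is
`R + ⌊a / 2⌋ | C + ⌊(a + 1) / 2⌋`. -/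
def zigzag {n : ℕ} (R C : ZMod n) (lo hi : ℕ) : MonomialDatum n where
  S := Finset.Icc lo hi
  row a := R + ((a.1 / 2 : ℕ) : ZMod n)
  col a := C + (((a.1 + 1) / 2 : ℕ) : ZMod n)
  L a := if h : a.1 % 2 = 1 ∧ a.1 + 1 ≤ hi then
    some ⟨a.1 + 1, Finset.mem_Icc.2 ⟨(Finset.mem_Icc.1 a.2).1.trans (Nat.le_succ _), h.2⟩⟩ else none
  R a := if h : a.1 % 2 = 1 ∧ lo + 1 ≤ a.1 then
    some ⟨a.1 - 1, Finset.mem_Icc.2 ⟨by omega, (Nat.sub_le _ _).trans (Finset.mem_Icc.1 a.2).2⟩⟩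
    else none
  L_row := by
    rintro ⟨s, hs⟩ ⟨t, ht⟩ h
    simp only [Option.mem_def, Option.dite_none_right_eq_some, Option.some.injEq,
      Subtype.mk.injEq] at h
    obtain ⟨h, rfl⟩ := h
    rw [show (s + 1) / 2 = s / 2 + 1 by omega]
    push_cast
    ring
  L_col := by
    rintro ⟨s, hs⟩ ⟨t, ht⟩ h
    simp only [Option.mem_def, Option.dite_none_right_eq_some, Option.some.injEq,
      Subtype.mk.injEq] at h
    obtain ⟨h, rfl⟩ := h
    rw [show (s + 1 + 1) / 2 = (s + 1) / 2 by omega]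
  L_L := by
    rintro ⟨s, hs⟩ ⟨t, ht⟩ h
    simp only [Option.mem_def, Option.dite_none_right_eq_some, Option.some.injEq,
      Subtype.mk.injEq] at h
    obtain ⟨h, rfl⟩ := h
    rw [dif_neg]
    dsimp only
    omega
  L_inj := by
    rintro ⟨s, hs⟩ ⟨s₂, hs'⟩ ⟨t, ht⟩ h h'
    simp only [Option.mem_def, Option.dite_none_right_eq_some, Option.some.injEq,
      Subtype.mk.injEq] at h h'
    obtain ⟨h, rfl⟩ := h
    obtain ⟨h', h2⟩ := h'
    exact Subtype.ext (by dsimp only; omega)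
  R_row := by
    rintro ⟨s, hs⟩ ⟨t, ht⟩ h
    simp only [Option.mem_def, Option.dite_none_right_eq_some, Option.some.injEq,
      Subtype.mk.injEq] at h
    obtain ⟨h, rfl⟩ := h
    rw [show (s - 1) / 2 = s / 2 by omega]
  R_col := by
    rintro ⟨s, hs⟩ ⟨t, ht⟩ h
    simp only [Option.mem_def, Option.dite_none_right_eq_some, Option.some.injEq,
      Subtype.mk.injEq] at h
    obtain ⟨h, rfl⟩ := h
    rw [show (s + 1) / 2 = (s - 1 + 1) / 2 + 1 by omega]
    push_cast
    ring
  R_R := by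
    rintro ⟨s, hs⟩ ⟨t, ht⟩ h
    simp only [Option.mem_def, Option.dite_none_right_eq_some, Option.some.injEq,
      Subtype.mk.injEq] at h
    obtain ⟨h, rfl⟩ := h
    rw [dif_neg]
    dsimp only
    omega
  R_inj := by
    rintro ⟨s, hs⟩ ⟨s₂, hs'⟩ ⟨t, ht⟩ h h'
    simp only [Option.mem_def, Option.dite_none_right_eq_some, Option.some.injEq,
      Subtype.mk.injEq] at h h'
    obtain ⟨h, rfl⟩ := h
    obtain ⟨h', h2⟩ := h'
    exact Subtype.ext (by dsimp only; omega)
  comm s := by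
    ext t
    simp only [Option.bind_eq_some_iff, Option.dite_none_right_eq_some, Option.some.injEq]
    constructor
    · rintro ⟨r, ⟨h, rfl⟩, h', -⟩
      dsimp only at h'
      omega
    · rintro ⟨r, ⟨h, rfl⟩, h', -⟩
      dsimp only at h'
      omega

namespace zigzag

variable {n : ℕ} {R C : ZMod n} {lo hi : ℕ}

theorem bounds (s : (zigzag R C lo hi).S) : lo ≤ s.1 ∧ s.1 ≤ hi := Finset.mem_Icc.1 s.2

theorem row_eq (s : (zigzag R C lo hi).S) :
    (zigzag R C lo hi).row s = R + ((s.1 / 2 : ℕ) : ZMod n) := rfl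

theorem col_eq (s : (zigzag R C lo hi).S) :
    (zigzag R C lo hi).col s = C + (((s.1 + 1) / 2 : ℕ) : ZMod n) := rfl

theorem mem_L {s t : (zigzag R C lo hi).S} :
    t ∈ (zigzag R C lo hi).L s ↔ s.1 % 2 = 1 ∧ t.1 = s.1 + 1 := by
  have ht := bounds t
  refine Option.dite_none_right_eq_some.trans ⟨?_, ?_⟩
  · rintro ⟨h, h'⟩
    exact ⟨h.1, (congrArg Subtype.val (Option.some.inj h')).symm⟩
  · rintro ⟨h, h'⟩
    exact ⟨⟨h, by omega⟩, congrArg some (Subtype.ext h'.symm)⟩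

theorem mem_R {s t : (zigzag R C lo hi).S} :
    t ∈ (zigzag R C lo hi).R s ↔ s.1 % 2 = 1 ∧ t.1 + 1 = s.1 := by
  have ht := bounds t
  refine Option.dite_none_right_eq_some.trans ⟨?_, ?_⟩
  · rintro ⟨h, h'⟩
    have h2 := congrArg Subtype.val (Option.some.inj h')
    dsimp only at h2
    exact ⟨h.1, by omega⟩
  · rintro ⟨h, h'⟩
    exact ⟨⟨h, by omega⟩, congrArg some (Subtype.ext (by dsimp only; omega))⟩

theorem mem_imL {t : (zigzag R C lo hi).S} :
    t ∈ (zigzag R C lo hi).imL ↔ t.1 % 2 = 0 ∧ lo < t.1 := by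
  have ht := bounds t
  constructor
  · rintro ⟨s, h⟩
    have := bounds s
    rw [mem_L] at h
    omega
  · rintro ⟨h, h'⟩
    refine ⟨⟨t.1 - 1, Finset.mem_Icc.2 (by omega)⟩, mem_L.2 ?_⟩
    dsimp only
    omega

theorem mem_imR {t : (zigzag R C lo hi).S} :
    t ∈ (zigzag R C lo hi).imR ↔ t.1 % 2 = 0 ∧ t.1 < hi := by
  have ht := bounds t
  constructor
  · rintro ⟨s, h⟩
    have := bounds s
    rw [mem_R] at h
    omega
  · rintro ⟨h, h'⟩
    refine ⟨⟨t.1 + 1, Finset.mem_Icc.2 (by omega)⟩, mem_R.2 ?_⟩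
    dsimp only
    omega

end zigzag

/-! ### String bimodules as zigzags, and their numerical invariants -/

namespace StringDatum

variable {n : ℕ} (r : StringDatum n)

/-- The position on the infinite zigzag walk, up to even translation, at which the walk starts. -/
def start : ℕ :=
  match r.course with
  | .right => 0
  | .down => 1

theorem start_le : r.start ≤ 1 := by
  unfold start
  cases r.course <;> simp

theorem isDown_iff (m : ℕ) : r.IsDown m ↔ (m + r.start) % 2 = 1 := by
  unfold IsDown start
  cases r.course
  · rw [Nat.odd_iff]; simp
  · rw [Nat.even_iff]; simp; omega

theorem rowOffset_eq (m : ℕ) : r.rowOffset m = (m + r.start) / 2 := by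
  have := r.start_le
  induction m with
  | zero => simp only [rowOffset]; omega
  | succ m ih =>
    simp only [rowOffset, ih, isDown_iff]
    split_ifs <;> omega

theorem colOffset_eq (m : ℕ) : r.colOffset m = (m + 1 - r.start) / 2 := by
  have := r.start_le
  induction m with
  | zero => simp only [colOffset]; omega
  | succ m ih =>
    simp only [colOffset, ih, isDown_iff]
    split_ifs <;> omega

/-- The datum of the standard basis of a string bimodule. -/
def zigzag : MonomialDatum n := _root_.zigzag r.row (r.col - r.start) r.start (r.start + r.length)

section

variable (k : Type u) [Field k]

theorem leftMatrix_mulVec_single (a : NakayamaAlgebra k n) (m : Fin (r.length + 1)) :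
    (r.leftMatrix k a).mulVec (Pi.single m 1) = a.1 (r.rowAt m) • Pi.single m 1 +
      if h : r.IsDown m ∧ m.1 + 1 < r.length + 1 then
        a.2 (r.rowAt m) • Pi.single ⟨m.1 + 1, h.2⟩ 1 else 0 := by
  ext m'
  rw [Matrix.mulVec_single_one]
  by_cases h1 : m' = m
  · subst h1
    split_ifs <;> simp [leftMatrix, Fin.ext_iff]
  · have h1' : ¬ m'.1 = m.1 := fun h => h1 (Fin.ext h)
    by_cases h2 : r.IsDown m
    · by_cases h3 : m.1 + 1 < r.length + 1
      · simp [leftMatrix, h1', h2, h3, Fin.ext_iff, Pi.single_apply]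
      · have : ¬ m'.1 = m.1 + 1 := by omega
        simp [leftMatrix, h1, h2, h3, this]
    · simp [leftMatrix, h1, h2]

theorem rightMatrix_mulVec_single (a : NakayamaAlgebra k n) (m : Fin (r.length + 1)) :
    (r.rightMatrix k a).mulVec (Pi.single m 1) = a.1 (r.colAt m) • Pi.single m 1 +
      if h : r.IsDown m ∧ 1 ≤ m.1 then
        a.2 (r.colAt (m.1 - 1)) • Pi.single ⟨m.1 - 1, by omega⟩ 1 else 0 := by
  ext m'
  rw [Matrix.mulVec_single_one]
  by_cases h1 : m' = m
  · subst h1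
    split_ifs with h
    · have : ¬ m'.1 = m'.1 - 1 := by omega
      simp [rightMatrix, Fin.ext_iff, this]
    · simp [rightMatrix]
  · have h1' : ¬ m'.1 = m.1 := fun h => h1 (Fin.ext h)
    by_cases h2 : m.1 = m'.1 + 1
    · have h3 := r.isDown_succ m'
      rw [← h2] at h3
      by_cases h5 : r.IsDown m'
      · rw [dif_neg (fun h => h3.1 h.1 h5)]
        simp [rightMatrix, h1, h5]
      · rw [dif_pos ⟨h3.2 h5, by omega⟩]
        simp [rightMatrix, h1, h2, h5]
    · split_ifs with h
      · have : ¬ m'.1 = m.1 - 1 := by omega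
        simp [rightMatrix, h1', h2, Fin.ext_iff, this]
      · simp [rightMatrix, h1, h2]

/-- The standard basis of a string bimodule, indexed by a part of the infinite zigzag walk. -/
noncomputable def zigzagBasis (R C : ZMod n) {lo hi : ℕ} (hhi : hi = lo + r.length) :
    Module.Basis (_root_.zigzag R C lo hi).S k (r.bimodule k).carrier :=
  (Pi.basisFun k (Fin (r.length + 1))).reindex
    { toFun := fun m => ⟨m.1 + lo, Finset.mem_Icc.2 (by omega)⟩
      invFun := fun a => ⟨a.1 - lo, by have := Finset.mem_Icc.1 a.2; omega⟩
      left_inv := fun m => by ext; simp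
      right_inv := fun a => Subtype.ext (by have := Finset.mem_Icc.1 a.2; dsimp only; omega) }

theorem zigzagBasis_apply (R C : ZMod n) {lo hi : ℕ} (hhi : hi = lo + r.length)
    (s : (_root_.zigzag R C lo hi).S) :
    r.zigzagBasis k R C hhi s =
      (Pi.single ⟨s.1 - lo, by have := zigzag.bounds s; omega⟩ 1 : Fin (r.length + 1) → k) := by
  exact (Module.Basis.reindex_apply (Pi.basisFun k (Fin (r.length + 1))) _ s).trans
    (Pi.basisFun_apply _ _ _)

/-- A string bimodule has a monomial basis given by a part of the infinite zigzag walk. -/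
noncomputable def monomialBasis {R C : ZMod n} {lo hi : ℕ}
    (hlo : lo % 2 = r.start) (hhi : hi = lo + r.length)
    (hR : r.row = R + ((lo / 2 : ℕ) : ZMod n)) (hC : r.col = C + (((lo + 1) / 2 : ℕ) : ZMod n)) :
    MonomialBasis (r.bimodule k) (_root_.zigzag R C lo hi) where
  basis := r.zigzagBasis k R C hhi
  left_basis a s := by
    have hs := zigzag.bounds s
    refine (congrArg _ (r.zigzagBasis_apply k R C hhi s)).trans
      ((r.leftMatrix_mulVec_single k a _).trans ?_)
    have hrow : (_root_.zigzag R C lo hi).row s = r.rowAt (s.1 - lo) := by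
      rw [zigzag.row_eq, rowAt, hR, rowOffset_eq, add_assoc, ← Nat.cast_add]
      congr 2
      omega
    by_cases h : s.1 % 2 = 1 ∧ s.1 + 1 ≤ hi
    · let t : (_root_.zigzag R C lo hi).S := ⟨s.1 + 1, Finset.mem_Icc.2 (by omega)⟩
      have ht : (_root_.zigzag R C lo hi).L s = some t := dif_pos h
      refine Eq.trans ?_ (MonomialDatum.leftVec_of_some (V := (r.bimodule k).carrier) _ _ ht a).symm
      rw [dif_pos ⟨(r.isDown_iff _).2 (by dsimp only; omega), by dsimp only; omega⟩,
        zigzagBasis_apply, zigzagBasis_apply, hrow]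
      simp only [t, Nat.sub_add_comm hs.1]
      rfl
    · have ht : (_root_.zigzag R C lo hi).L s = none := dif_neg h
      refine Eq.trans ?_ (MonomialDatum.leftVec_of_none (V := (r.bimodule k).carrier) _ _ ht a).symm
      rw [dif_neg, add_zero, zigzagBasis_apply, hrow]
      · rfl
      · rw [isDown_iff]
        dsimp only
        omega
  right_basis a s := by
    have hs := zigzag.bounds s
    refine (congrArg _ (r.zigzagBasis_apply k R C hhi s)).trans
      ((r.rightMatrix_mulVec_single k a _).trans ?_)
    have hcol : ∀ s, (_root_.zigzag R C lo hi).col s = r.colAt (s.1 - lo) := fun s => by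
      have hs := zigzag.bounds s
      rw [zigzag.col_eq, colAt, hC, colOffset_eq, add_assoc, ← Nat.cast_add]
      congr 2
      omega
    by_cases h : s.1 % 2 = 1 ∧ lo + 1 ≤ s.1
    · let t : (_root_.zigzag R C lo hi).S := ⟨s.1 - 1, Finset.mem_Icc.2 (by omega)⟩
      have ht : (_root_.zigzag R C lo hi).R s = some t := dif_pos h
      refine Eq.trans ?_ (MonomialDatum.rightVec_of_some (V := (r.bimodule k).carrier) _ _ ht a).symm
      rw [dif_pos ⟨(r.isDown_iff _).2 (by dsimp only; omega), by dsimp only; omega⟩,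
        zigzagBasis_apply, zigzagBasis_apply, hcol, hcol]
      simp only [t, Nat.sub_right_comm]
      rfl
    · have ht : (_root_.zigzag R C lo hi).R s = none := dif_neg h
      refine Eq.trans ?_ (MonomialDatum.rightVec_of_none (V := (r.bimodule k).carrier) _ _ ht a).symm
      rw [dif_neg, add_zero, zigzagBasis_apply, hcol]
      · rfl
      · rw [isDown_iff]
        dsimp only
        omega

end

theorem ncard_imL : r.zigzag.imL.ncard = (r.length + r.start) / 2 := by
  have := r.start_le
  rw [← Finset.card_range ((r.length + r.start) / 2), ← Set.ncard_coe_finset]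
  refine Set.ncard_congr (fun s _ => s.1 / 2 - 1) ?_ ?_ ?_
  · intro s hs
    have := zigzag.bounds s
    have := zigzag.mem_imL.1 hs
    simp only [Finset.coe_range, Set.mem_Iio]
    omega
  · intro s t hs ht h
    have := zigzag.mem_imL.1 hs
    have := zigzag.mem_imL.1 ht
    exact Subtype.ext (by omega)
  · intro j hj
    simp only [Finset.coe_range, Set.mem_Iio] at hj
    exact ⟨⟨2 * j + 2, Finset.mem_Icc.2 (by omega)⟩,
      zigzag.mem_imL.2 (by dsimp only; omega), by dsimp only; omega⟩

theorem ncard_imR : r.zigzag.imR.ncard = (r.length + 1 - r.start) / 2 := by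
  have := r.start_le
  rw [← Finset.card_range ((r.length + 1 - r.start) / 2), ← Set.ncard_coe_finset]
  refine Set.ncard_congr (fun s _ => s.1 / 2 - r.start) ?_ ?_ ?_
  · intro s hs
    have := zigzag.bounds s
    have := zigzag.mem_imR.1 hs
    simp only [Finset.coe_range, Set.mem_Iio]
    omega
  · intro s t hs ht h
    have := zigzag.bounds s
    have := zigzag.bounds t
    have := zigzag.mem_imR.1 hs
    have := zigzag.mem_imR.1 ht
    exact Subtype.ext (by omega)
  · intro j hj
    simp only [Finset.coe_range, Set.mem_Iio] at hj
    exact ⟨⟨2 * (j + r.start), Finset.mem_Icc.2 (by omega)⟩,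
      zigzag.mem_imR.2 (by dsimp only; omega), by dsimp only; omega⟩

/-- Each down step opens a new row and ends at its own element of `imL`. This turns the height into
an isomorphism invariant; `width_eq` and `valleys_eq` do the same with `imR` and `imL ∩ imR`. -/
theorem height_eq : r.height = r.zigzag.imL.ncard + 1 := by
  have := r.start_le
  have h : (Finset.range (r.length + 1)).image r.rowOffset =
      Finset.range ((r.length + r.start) / 2 + 1) := by
    ext j
    simp only [Finset.mem_image, Finset.mem_range, rowOffset_eq]
    constructor
    · rintro ⟨m, hm, rfl⟩; omega
    · intro h; exact ⟨2 * j - r.start, by omega, by omega⟩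
  rw [height, h, ncard_imL, Finset.card_range]

theorem width_eq : r.width = r.zigzag.imR.ncard + 1 := by
  have := r.start_le
  have h : (Finset.range (r.length + 1)).image r.colOffset =
      Finset.range ((r.length + 1 - r.start) / 2 + 1) := by
    ext j
    simp only [Finset.mem_image, Finset.mem_range, colOffset_eq]
    constructor
    · rintro ⟨m, hm, rfl⟩; omega
    · intro h; exact ⟨2 * j - (1 - r.start), by omega, by omega⟩
  rw [width, h, ncard_imR, Finset.card_range]

theorem valleys_eq : r.valleys = (r.zigzag.imL ∩ r.zigzag.imR).ncard := by
  rw [valleys, ← Set.ncard_coe_finset, eq_comm]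
  refine Set.ncard_congr (fun s _ => s.1 - r.start) ?_ ?_ ?_
  · intro s hs
    have := zigzag.bounds s
    have h1 := zigzag.mem_imL.1 hs.1
    have h2 := zigzag.mem_imR.1 hs.2
    simp only [Finset.coe_filter, Finset.mem_range, isDown_iff, Set.mem_ofPred_eq]
    omega
  · intro s t hs ht h
    have := zigzag.bounds s
    have := zigzag.bounds t
    exact Subtype.ext (by omega)
  · intro j hj
    simp only [Finset.coe_filter, Finset.mem_range, isDown_iff, Set.mem_ofPred_eq] at hj
    exact ⟨⟨j + r.start, Finset.mem_Icc.2 (by omega)⟩,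
      ⟨zigzag.mem_imL.2 (by dsimp only; omega), zigzag.mem_imR.2 (by dsimp only; omega)⟩,
      by dsimp only; omega⟩

/-- A walk has one vertex more than steps; `imL` counts the down steps and `imR` the right steps.
This identity later distinguishes strings from squares. -/
theorem natCard_eq : Nat.card r.zigzag.S = r.zigzag.imL.ncard + r.zigzag.imR.ncard + 1 := by
  have h := r.start_le
  have h1 : Nat.card r.zigzag.S = (Finset.Icc r.start (r.start + r.length)).card :=
    Nat.card_eq_finsetCard _
  rw [h1, ncard_imL, ncard_imR, Nat.card_Icc]
  omega

end StringDatum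

/-! ### Tensor products of monomial bimodules -/

namespace Bimodule

variable {k A : Type u} [Field k] [Ring A] [Algebra k A] (X Y : Bimodule k A)

/-- The canonical bilinear map `X × Y → X ⊗_A Y`. -/
def tensorMk : X.carrier →ₗ[k] Y.carrier →ₗ[k] (tensor X Y).carrier :=
  (TensorProduct.mk k X.carrier Y.carrier).compr₂ (balanced X Y).mkQ

theorem tensorMk_balanced (x : X.carrier) (a : A) (y : Y.carrier) :
    tensorMk X Y (X.right (MulOpposite.op a) x) y = tensorMk X Y x (Y.left a y) :=
  (Submodule.Quotient.eq _).2 (Submodule.subset_span ⟨x, a, y, rfl⟩)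

theorem left_tensorMk (a : A) (x : X.carrier) (y : Y.carrier) :
    (tensor X Y).left a (tensorMk X Y x y) = tensorMk X Y (X.left a x) y := rfl

theorem right_tensorMk (a : Aᵐᵒᵖ) (x : X.carrier) (y : Y.carrier) :
    (tensor X Y).right a (tensorMk X Y x y) = tensorMk X Y x (Y.right a y) := rfl

theorem tensor_hom_ext {V : Type*} [AddCommGroup V] [Module k V]
    {f g : (tensor X Y).carrier →ₗ[k] V}
    (h : ∀ x y, f (tensorMk X Y x y) = g (tensorMk X Y x y)) : f = g :=
  Submodule.linearMap_qext (balanced X Y) (TensorProduct.ext' h)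

/-- The linear map on `X ⊗_A Y` induced by a balanced bilinear map. -/
def tensorLift {V : Type*} [AddCommGroup V] [Module k V] (f : X.carrier →ₗ[k] Y.carrier →ₗ[k] V)
    (hf : ∀ x a y, f (X.right (MulOpposite.op a) x) y = f x (Y.left a y)) :
    (tensor X Y).carrier →ₗ[k] V :=
  (balanced X Y).liftQ (TensorProduct.lift f) (by
    refine Submodule.span_le.2 ?_
    rintro _ ⟨x, a, y, rfl⟩
    simp [hf])

theorem tensorLift_tensorMk {V : Type*} [AddCommGroup V] [Module k V]
    (f : X.carrier →ₗ[k] Y.carrier →ₗ[k] V)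
    (hf : ∀ x a y, f (X.right (MulOpposite.op a) x) y = f x (Y.left a y)) (x : X.carrier)
    (y : Y.carrier) : tensorLift X Y f hf (tensorMk X Y x y) = f x y :=
  TensorProduct.lift.tmul x y

end Bimodule

namespace MonomialBasis

variable {k : Type u} [Field k] {n : ℕ} {X Y : Bimodule k (NakayamaAlgebra k n)}
  {DX DY T : MonomialDatum n} (BX : MonomialBasis X DX) (BY : MonomialBasis Y DY)

open Bimodule

/-- The idempotent of the column of `a` fixes the first factor and, moved across the tensor sign,
kills the second. -/
theorem tensorMk_of_col_ne_row {a : DX.S} {b : DY.S} (h : DX.col a ≠ DY.row b) :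
    tensorMk X Y (BX.basis a) (BY.basis b) = 0 := by
  have := tensorMk_balanced X Y (BX.basis a) (NakayamaAlgebra.vertex (DX.col a)) (BY.basis b)
  rw [BX.right_basis, BY.left_basis, MonomialDatum.rightVec, MonomialDatum.leftVec,
    NakayamaAlgebra.vertex_fst_of_ne h.symm] at this
  cases h1 : DX.R a <;> cases h2 : DY.L b <;> simpa [h1, h2] using this

/-- The first factor is `x_{a'} α`, and `α` is moved to the second. In `tensorMk_of_mem_L` an arrow
moves in the opposite direction. -/
theorem tensorMk_of_mem_R {a a' : DX.S} {b : DY.S} (ha : a ∈ DX.R a') (h : DX.col a = DY.row b) :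
    tensorMk X Y (BX.basis a) (BY.basis b) =
      (DY.L b).elim 0 fun b' => tensorMk X Y (BX.basis a') (BY.basis b') := by
  have := tensorMk_balanced X Y (BX.basis a') (NakayamaAlgebra.arrow (DX.col a)) (BY.basis b)
  rw [Option.mem_def] at ha
  rw [BX.right_basis, BY.left_basis, MonomialDatum.rightVec, MonomialDatum.leftVec, ← h, ha] at this
  cases h2 : DY.L b <;> simpa [h2] using this

theorem tensorMk_of_mem_L {a : DX.S} {b b' : DY.S} (hb : b ∈ DY.L b') (h : DX.col a = DY.row b) :
    tensorMk X Y (BX.basis a) (BY.basis b) =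
      (DX.R a).elim 0 fun a' => tensorMk X Y (BX.basis a') (BY.basis b') := by
  have := tensorMk_balanced X Y (BX.basis a) (NakayamaAlgebra.arrow (DY.row b')) (BY.basis b')
  have hb' := DY.L_row hb
  rw [Option.mem_def] at hb
  rw [BX.right_basis, BY.left_basis, MonomialDatum.rightVec, MonomialDatum.leftVec, hb] at this
  cases h2 : DX.R a with
  | none => simpa [h2, eq_comm] using this
  | some a' =>
    have h3 : DX.col a' = DY.row b' := by
      have := DX.R_col h2
      rw [h, hb'] at this
      exact (add_right_cancel this).symm
    simpa [h2, h3, eq_comm] using this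

/-- A monomial basis of a tensor product, given a normal form `nf` for the products of basis
vectors. -/
noncomputable def tensor (nf : DX.S → DY.S → Option T.S) (rep : T.S → DX.S × DY.S)
    (hcr : ∀ {a b t}, t ∈ nf a b → DX.col a = DY.row b)
    (hrow : ∀ {a b t}, t ∈ nf a b → T.row t = DX.row a)
    (hcol : ∀ {a b t}, t ∈ nf a b → T.col t = DY.col b)
    (hnf : ∀ a b, (DX.R a).bind (fun a' => nf a' b) = (DY.L b).bind (nf a))
    (hrep : ∀ t, nf (rep t).1 (rep t).2 = some t)
    (hmk : ∀ a b, tensorMk X Y (BX.basis a) (BY.basis b) =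
      (nf a b).elim 0 fun t => tensorMk X Y (BX.basis (rep t).1) (BY.basis (rep t).2))
    (hL : ∀ t, T.L t = (DX.L (rep t).1).bind fun a => nf a (rep t).2)
    (hR : ∀ t, T.R t = (DY.R (rep t).2).bind (nf (rep t).1)) :
    MonomialBasis (Bimodule.tensor X Y) T :=
  let v (a : DX.S) (b : DY.S) : T.S →₀ k := (nf a b).elim 0 fun t => Finsupp.single t 1
  let f : X.carrier →ₗ[k] Y.carrier →ₗ[k] T.S →₀ k :=
    BX.basis.constr k fun a => BY.basis.constr k fun b => v a b
  have hfv (a : DX.S) (b : DY.S) : f (BX.basis a) (BY.basis b) = v a b := by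
    simp [f]
  have hf (x : X.carrier) (c : NakayamaAlgebra k n) (y : Y.carrier) :
      f (X.right (MulOpposite.op c) x) y = f x (Y.left c y) := by
    have : f.comp (X.right (MulOpposite.op c)) = f.compl₂ (Y.left c) := by
      refine BX.basis.ext fun a => BY.basis.ext fun b => ?_
      rw [LinearMap.comp_apply, LinearMap.compl₂_apply, BX.right_basis, BY.left_basis,
        MonomialDatum.map_leftVec]
      refine (DX.map_rightVec (f.flip (BY.basis b)) BX.basis c a).trans ?_
      rw [MonomialDatum.rightVec, MonomialDatum.leftVec]
      simp only [LinearMap.flip_apply, hfv]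
      congr 1
      -- Idempotent coefficients agree because a nonzero product has matching column and row
      -- (`hcr`); arrow coefficients agree by `hnf`, the relation `x α ⊗ y = x ⊗ α y` in normal
      -- forms.
      · cases h : nf a b with
        | none => simp [v, h]
        | some t => rw [hcr h]
      · have h1 := hnf a b
        cases hRa : DX.R a with
        | none =>
          cases hLb : DY.L b with
          | none => rfl
          | some b' =>
            have h2 : nf a b' = none := by simpa [hRa, hLb] using h1.symm
            simp [v, h2]
        | some a' =>
          cases hLb : DY.L b with
          | none =>
            have h2 : nf a' b = none := by simpa [hRa, hLb] using h1
            simp [v, h2]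
          | some b' =>
            have h2 : nf a' b = nf a b' := by simpa [hRa, hLb] using h1
            cases h3 : nf a' b with
            | none => simp [v, h3, ← h2]
            | some t => simp [v, h3, ← h2, hcr h3]
    exact LinearMap.congr_fun₂ this x y
  let Φ := tensorLift X Y f hf
  let r (t : T.S) := tensorMk X Y (BX.basis (rep t).1) (BY.basis (rep t).2)
  let Ψ : (T.S →₀ k) →ₗ[k] (Bimodule.tensor X Y).carrier := Finsupp.linearCombination k r
  have hΨ (t : T.S) : Ψ (Finsupp.single t 1) = r t := by simp [Ψ]
  have hΦ (t : T.S) : Φ (r t) = Finsupp.single t 1 := by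
    simp only [Φ, r, tensorLift_tensorMk, hfv, v, hrep, Option.elim_some]
  -- `Φ` comes from the universal property and `Ψ` from the representatives. They are mutually
  -- inverse: `hrep` gives one composite and `hmk` the other.
  have h1 : Φ ∘ₗ Ψ = LinearMap.id := by
    ext t : 2
    rw [LinearMap.comp_apply, LinearMap.comp_apply, Finsupp.lsingle_apply, hΨ, hΦ]
    rfl
  have h2 : Ψ ∘ₗ Φ = LinearMap.id := by
    refine tensor_hom_ext X Y fun x y => ?_
    have : (tensorMk X Y).compr₂ (Ψ ∘ₗ Φ) = tensorMk X Y := by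
      refine BX.basis.ext fun a => BY.basis.ext fun b => ?_
      rw [LinearMap.compr₂_apply, LinearMap.comp_apply, hmk a b]
      cases nf a b with
      | none => simp
      | some t => rw [Option.elim_some]; exact (congrArg Ψ (hΦ t)).trans (hΨ t)
    exact LinearMap.congr_fun₂ this x y
  let b : Module.Basis T.S k (Bimodule.tensor X Y).carrier := .ofRepr (.ofLinearMap Φ Ψ h1 h2)
  have hb (t : T.S) : b t = r t := hΨ t
  have hb' (x : DX.S) (y : DY.S) :
      tensorMk X Y (BX.basis x) (BY.basis y) = (nf x y).elim 0 fun t => b t := by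
    simp only [hb]; exact hmk x y
  { basis := b
    left_basis := fun c t => by
      rw [hb]
      refine (left_tensorMk X Y c _ _).trans ?_
      rw [BX.left_basis]
      refine (DX.map_leftVec ((tensorMk X Y).flip (BY.basis (rep t).2)) BX.basis c (rep t).1).trans ?_
      simp only [LinearMap.flip_apply]
      rw [MonomialDatum.leftVec, MonomialDatum.leftVec, hrow (hrep t), hL, hb' (rep t).1, hrep]
      cases DX.L (rep t).1 with
      | none => rfl
      | some a =>
        simp only [Option.elim_some, Option.bind_some, hb']
        cases nf a (rep t).2 <;> simp
    right_basis := fun c t => by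
      rw [hb]
      refine (right_tensorMk X Y (MulOpposite.op c) _ _).trans ?_
      rw [BY.right_basis]
      refine (DY.map_rightVec (tensorMk X Y (BX.basis (rep t).1)) BY.basis c (rep t).2).trans ?_
      rw [MonomialDatum.rightVec, MonomialDatum.rightVec, hcol (hrep t), hR, hb' (rep t).1, hrep]
      cases DY.R (rep t).2 with
      | none => rfl
      | some a =>
        simp only [Option.elim_some, Option.bind_some, hb']
        cases h : nf (rep t).1 a with
        | none => simp
        | some u => simp [hcol h] }

end MonomialBasis

/-! ### The tensor product of two zigzags -/

namespace zigzag

variable {n : ℕ}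

/-- The pairs `(a, b)` for which `x_a ⊗ y_b` belongs to the standard basis of the tensor product of
the bimodules of `zigzag R C s e` and `zigzag R₂ C₂ s₂ e₂`. -/
structure IsTensorVertex (C R₂ : ZMod n) (s e s₂ e₂ : ℕ) (x : ℕ × ℕ) : Prop where
  le_fst : s ≤ x.1
  fst_le : x.1 ≤ e
  le_snd : s₂ ≤ x.2
  snd_le : x.2 ≤ e₂
  col_eq_row : C + (((x.1 + 1) / 2 : ℕ) : ZMod n) = R₂ + ((x.2 / 2 : ℕ) : ZMod n)
  fst : x.1 % 2 = 1 ∨ x.1 = e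
  snd : (x.1 % 2 = 1 ∧ s < x.1) ∨ x.2 % 2 = 1 ∨ x.2 = s₂

variable (R C : ZMod n) (s e : ℕ) (R₂ C₂ : ZMod n) (s₂ e₂ : ℕ)

/-- The standard basis of the tensor product of two zigzags. -/
abbrev TensorVertex : Type := {x : ℕ × ℕ // IsTensorVertex C R₂ s e s₂ e₂ x}

variable {C R₂ s e s₂ e₂}

/-- Hypothesis `h2` places `x` and `y` on the same diagonal, written additively to avoid
subtraction; the congruence between column and row then passes from `x` to `y`. -/
theorem IsTensorVertex.congr {x y : ℕ × ℕ} (h : IsTensorVertex C R₂ s e s₂ e₂ x)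
    (h1 : s ≤ y.1 ∧ y.1 ≤ e ∧ s₂ ≤ y.2 ∧ y.2 ≤ e₂)
    (h2 : (y.1 + 1) / 2 + x.2 / 2 = (x.1 + 1) / 2 + y.2 / 2)
    (h3 : y.1 % 2 = 1 ∨ y.1 = e) (h4 : (y.1 % 2 = 1 ∧ s < y.1) ∨ y.2 % 2 = 1 ∨ y.2 = s₂) :
    IsTensorVertex C R₂ s e s₂ e₂ y := by
  refine ⟨h1.1, h1.2.1, h1.2.2.1, h1.2.2.2, ?_, h3, h4⟩
  have h5 := congrArg (Nat.cast (R := ZMod n)) h2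
  rw [Nat.cast_add, Nat.cast_add] at h5
  linear_combination h.col_eq_row + h5

open Classical in
/-- The expression of `x_a ⊗ y_b` in the standard basis. -/
noncomputable def normalForm (a b : ℕ) : Option (TensorVertex C s e R₂ s₂ e₂) :=
  if h : IsTensorVertex C R₂ s e s₂ e₂ (a, b) then some ⟨_, h⟩
  else if h : IsTensorVertex C R₂ s e s₂ e₂ (a + 1, b + 1) ∧ a % 2 = 0 ∧ b % 2 = 1 then
    some ⟨_, h.1⟩
  else none

/-- The two alternatives exclude each other: a standard pair with `a` even has `a = e`, so `a + 1`
is out of range. The case order in `normalForm` is thus immaterial. -/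
theorem mem_normalForm {a b : ℕ} {t : TensorVertex C s e R₂ s₂ e₂} :
    t ∈ normalForm a b ↔ (t.1.1 = a ∧ t.1.2 = b) ∨
      (a % 2 = 0 ∧ b % 2 = 1 ∧ t.1.1 = a + 1 ∧ t.1.2 = b + 1) := by
  obtain ⟨⟨x, y⟩, h⟩ := t
  unfold normalForm
  split_ifs with h1 h2
  · simp only [Option.mem_def, Option.some.injEq, Subtype.mk.injEq, Prod.mk.injEq]
    have := h.fst_le
    have := h1.fst
    dsimp only at *
    omega
  · simp only [Option.mem_def, Option.some.injEq, Subtype.mk.injEq, Prod.mk.injEq]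
    constructor
    · omega
    · rintro (⟨rfl, rfl⟩ | h3)
      · exact absurd h h1
      · omega
  · simp only [Option.mem_def, reduceCtorEq, false_iff]
    rintro (⟨rfl, rfl⟩ | ⟨h3, h4, rfl, rfl⟩)
    · exact h1 h
    · exact h2 ⟨h, h3, h4⟩

/-- The left action on the standard basis of a tensor product of zigzags. -/
noncomputable def tensorL (t : TensorVertex C s e R₂ s₂ e₂) : Option (TensorVertex C s e R₂ s₂ e₂) :=
  if t.1.1 % 2 = 1 then normalForm (t.1.1 + 1) t.1.2 else none

/-- The right action on the standard basis of a tensor product of zigzags. -/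
noncomputable def tensorR (t : TensorVertex C s e R₂ s₂ e₂) : Option (TensorVertex C s e R₂ s₂ e₂) :=
  if t.1.2 % 2 = 1 then normalForm t.1.1 (t.1.2 - 1) else none

/-- The left arrow gives `x_{a+1} ⊗ y_b`. With `a + 1` even, this is either standard, at the end `a
+ 1 = e`, or rewritten as `x_{a+2} ⊗ y_{b+1}`. -/
theorem mem_tensorL {t u : TensorVertex C s e R₂ s₂ e₂} :
    u ∈ tensorL t ↔ t.1.1 % 2 = 1 ∧ ((u.1.1 = t.1.1 + 1 ∧ u.1.2 = t.1.2) ∨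
      (t.1.2 % 2 = 1 ∧ u.1.1 = t.1.1 + 2 ∧ u.1.2 = t.1.2 + 1)) := by
  rw [tensorL, Option.mem_ite_none_right]
  refine and_congr_right fun h => ?_
  rw [mem_normalForm]
  omega

/-- The right arrow gives `x_a ⊗ y_{b-1}` with `b - 1` even, and rewriting needs an odd second
index; so only the unreduced pair can occur. -/
theorem mem_tensorR {t u : TensorVertex C s e R₂ s₂ e₂} :
    u ∈ tensorR t ↔ t.1.2 % 2 = 1 ∧ u.1.1 = t.1.1 ∧ u.1.2 + 1 = t.1.2 := by
  rw [tensorR, Option.mem_ite_none_right]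
  refine and_congr_right fun h => ?_
  rw [mem_normalForm]
  omega

variable (C R₂ s e s₂ e₂) in
/-- The monomial datum of the tensor product of two zigzags. -/
noncomputable def tensorDatum : MonomialDatum n where
  S := TensorVertex C s e R₂ s₂ e₂
  finite := Set.Finite.to_subtype <| ((Set.finite_Iic e).prod (Set.finite_Iic e₂)).subset
    fun _ h => ⟨h.fst_le, h.snd_le⟩
  row t := R + ((t.1.1 / 2 : ℕ) : ZMod n)
  col t := C₂ + (((t.1.2 + 1) / 2 : ℕ) : ZMod n)
  L := tensorL
  R := tensorR
  L_row {t u} h := by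
    rw [mem_tensorL] at h
    rw [add_assoc, ← Nat.cast_add_one]
    congr 2
    omega
  L_col {t u} h := by
    rw [mem_tensorL] at h
    congr 2
    omega
  L_L {t u} h := by
    -- Only a move to `(a + 2, b + 1)` leaves the first coordinate odd. A second move would end at
    -- an even first coordinate with second coordinate `b + 1`, which is even and greater than `s₂`;
    -- this is not standard.
    refine Option.eq_none_iff_forall_not_mem.2 fun v hv => ?_
    rw [mem_tensorL] at h hv
    have := t.2.le_snd
    have := v.2.fst
    have := v.2.snd
    omega
  L_inj {t t' u} h h' := by
    rw [mem_tensorL] at h h'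
    exact Subtype.ext (Prod.ext (by omega) (by omega))
  R_row {t u} h := by
    rw [mem_tensorR] at h
    congr 2
    omega
  R_col {t u} h := by
    rw [mem_tensorR] at h
    rw [add_assoc, ← Nat.cast_add_one]
    congr 2
    omega
  R_R {t u} h := by
    refine Option.eq_none_iff_forall_not_mem.2 fun v hv => ?_
    rw [mem_tensorR] at h hv
    omega
  R_inj {t t' u} h h' := by
    rw [mem_tensorR] at h h'
    exact Subtype.ext (Prod.ext (by omega) (by omega))
  comm t := by
    ext v
    have h1 := t.2
    have h2 := v.2
    have := h1.le_fst
    have := h1.fst_le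
    have := h1.le_snd
    have := h1.snd_le
    have := h2.le_fst
    have := h2.fst_le
    have := h2.le_snd
    have := h2.snd_le
    have := h2.fst
    have := h2.snd
    refine Option.bind_eq_some_iff.trans (Iff.trans ?_ Option.bind_eq_some_iff.symm)
    constructor
    · rintro ⟨u, hu, hv⟩
      replace hu := mem_tensorL.1 hu
      replace hv := mem_tensorR.1 hv
      -- The intermediate vertex is the other corner of the square spanned by `t` and `v`.
      refine ⟨⟨(t.1.1, v.1.2), h1.congr ?_ ?_ ?_ ?_⟩, mem_tensorR.2 ?_, mem_tensorL.2 ?_⟩ <;>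
        dsimp only <;> omega
    · rintro ⟨u, hu, hv⟩
      replace hu := mem_tensorR.1 hu
      replace hv := mem_tensorL.1 hv
      refine ⟨⟨(v.1.1, t.1.2), h1.congr ?_ ?_ ?_ ?_⟩, mem_tensorL.2 ?_, mem_tensorR.2 ?_⟩ <;>
        dsimp only <;> omega

theorem mem_tensorDatum_L {t u : (tensorDatum R C s e R₂ C₂ s₂ e₂).S} :
    u ∈ (tensorDatum R C s e R₂ C₂ s₂ e₂).L t ↔ t.1.1 % 2 = 1 ∧
      ((u.1.1 = t.1.1 + 1 ∧ u.1.2 = t.1.2) ∨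
      (t.1.2 % 2 = 1 ∧ u.1.1 = t.1.1 + 2 ∧ u.1.2 = t.1.2 + 1)) := mem_tensorL

theorem mem_tensorDatum_R {t u : (tensorDatum R C s e R₂ C₂ s₂ e₂).S} :
    u ∈ (tensorDatum R C s e R₂ C₂ s₂ e₂).R t ↔
      t.1.2 % 2 = 1 ∧ u.1.1 = t.1.1 ∧ u.1.2 + 1 = t.1.2 := mem_tensorR

/-- The first component of a vertex of the tensor product. -/
def TensorVertex.fst (R : ZMod n) (t : TensorVertex C s e R₂ s₂ e₂) : (zigzag R C s e).S :=
  ⟨t.1.1, Finset.mem_Icc.2 ⟨t.2.le_fst, t.2.fst_le⟩⟩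

/-- The second component of a vertex of the tensor product. -/
def TensorVertex.snd (C₂ : ZMod n) (t : TensorVertex C s e R₂ s₂ e₂) : (zigzag R₂ C₂ s₂ e₂).S :=
  ⟨t.1.2, Finset.mem_Icc.2 ⟨t.2.le_snd, t.2.snd_le⟩⟩

end zigzag

namespace MonomialBasis

variable {k : Type u} [Field k] {n : ℕ} {X Y : Bimodule k (NakayamaAlgebra k n)}
  {R C : ZMod n} {s e : ℕ} {R₂ C₂ : ZMod n} {s₂ e₂ : ℕ}

open zigzag

theorem tensorMk_zigzag (BX : MonomialBasis X (zigzag R C s e))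
    (BY : MonomialBasis Y (zigzag R₂ C₂ s₂ e₂)) (a : (zigzag R C s e).S)
    (b : (zigzag R₂ C₂ s₂ e₂).S) :
    Bimodule.tensorMk X Y (BX.basis a) (BY.basis b) =
      (normalForm (C := C) (s := s) (e := e) (R₂ := R₂) (s₂ := s₂) (e₂ := e₂) a.1 b.1).elim 0
        fun t => Bimodule.tensorMk X Y (BX.basis (t.fst R)) (BY.basis (t.snd C₂)) := by
  have ha := bounds a
  have hb := bounds b
  cases h : normalForm (C := C) (s := s) (e := e) (R₂ := R₂) (s₂ := s₂) (e₂ := e₂) a.1 b.1 with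
  | some t =>
    rw [Option.elim_some]
    rcases mem_normalForm.1 h with ⟨h1, h2⟩ | ⟨h1, h2, h3, h4⟩
    · rw [show a = t.fst R from Subtype.ext h1.symm, show b = t.snd C₂ from Subtype.ext h2.symm]
    · have h5 : t.snd C₂ ∈ (zigzag R₂ C₂ s₂ e₂).L b := mem_L.2 ⟨h2, h4⟩
      rw [BX.tensorMk_of_mem_R BY (a' := t.fst R) (mem_R.2 ?_), Option.mem_def.1 h5,
        Option.elim_some]
      · have h6 := t.2.col_eq_row
        rw [show (t.1.1 + 1) / 2 = (a.1 + 1) / 2 + 1 by omega,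
          show t.1.2 / 2 = b.1 / 2 + 1 by omega] at h6
        push_cast at h6
        rw [col_eq, row_eq]
        linear_combination h6
      · simp only [TensorVertex.fst]
        omega
  | none =>
    rw [Option.elim_none]
    have h := Option.eq_none_iff_forall_not_mem.1 h
    simp only [mem_normalForm] at h
    by_cases hm : (zigzag R C s e).col a = (zigzag R₂ C₂ s₂ e₂).row b
    swap
    · exact BX.tensorMk_of_col_ne_row BY hm
    -- Here `x_a = x_{a+1} α`. If `α y_b` were nonzero, then `(a + 1, b + 1)` would be standard,
    -- against `h`.
    by_cases hae : a.1 % 2 = 0 ∧ a.1 < e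
    · have hL : (zigzag R₂ C₂ s₂ e₂).L b = none := by
        refine Option.eq_none_iff_forall_not_mem.2 fun b' hb' => ?_
        have := bounds b'
        rw [mem_L] at hb'
        refine h ⟨(a.1 + 1, b.1 + 1), ⟨?_, ?_, ?_, ?_, ?_, ?_, ?_⟩⟩ (Or.inr ⟨hae.1, hb'.1, rfl, rfl⟩)
          <;> dsimp only
        · omega
        · omega
        · omega
        · omega
        · rw [col_eq, row_eq] at hm
          rw [show (a.1 + 1 + 1) / 2 = (a.1 + 1) / 2 + 1 by omega,
            show (b.1 + 1) / 2 = b.1 / 2 + 1 by omega]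
          push_cast
          linear_combination hm
        · omega
        · omega
      rw [BX.tensorMk_of_mem_R BY (a' := ⟨a.1 + 1, Finset.mem_Icc.2 (by omega)⟩) (mem_R.2 ?_) hm, hL,
        Option.elim_none]
      dsimp only
      omega
    -- Now `a` is odd or equal to `e`, so the pair can fail to be standard only through the
    -- condition `snd`. Hence `y_b = α y_{b-1}`, while `x_a α = 0`.
    · have h1 : ¬ ((a.1 % 2 = 1 ∧ s < a.1) ∨ b.1 % 2 = 1 ∨ b.1 = s₂) := fun h1 =>
        h ⟨(a.1, b.1), ⟨ha.1, ha.2, hb.1, hb.2, hm, by dsimp only; omega, h1⟩⟩ (Or.inl ⟨rfl, rfl⟩)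
      have hR : (zigzag R C s e).R a = none := by
        refine Option.eq_none_iff_forall_not_mem.2 fun a' ha' => ?_
        have := bounds a'
        rw [mem_R] at ha'
        omega
      rw [BX.tensorMk_of_mem_L BY (b' := ⟨b.1 - 1, Finset.mem_Icc.2 (by omega)⟩) (mem_L.2 ?_) hm, hR,
        Option.elim_none]
      dsimp only
      omega

/-- The standard basis of the tensor product of two zigzags. -/
noncomputable def zigzagTensor (BX : MonomialBasis X (zigzag R C s e))
    (BY : MonomialBasis Y (zigzag R₂ C₂ s₂ e₂)) :
    MonomialBasis (Bimodule.tensor X Y) (tensorDatum R C s e R₂ C₂ s₂ e₂) :=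
  BX.tensor BY (fun a b => normalForm a.1 b.1)
    (fun t => (TensorVertex.fst R t, TensorVertex.snd C₂ t))
    (by
      intro a b t h
      have h := mem_normalForm.1 h
      have h2 := t.2.col_eq_row
      rw [col_eq, row_eq]
      rcases h with ⟨h3, h4⟩ | ⟨h3, h4, h5, h6⟩
      · rwa [h3, h4] at h2
      · rw [show (t.1.1 + 1) / 2 = (a.1 + 1) / 2 + 1 by omega,
          show t.1.2 / 2 = b.1 / 2 + 1 by omega] at h2
        push_cast at h2
        linear_combination h2)
    (by
      intro a b t h
      have h := mem_normalForm.1 h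
      refine congrArg (fun m : ℕ => R + (m : ZMod n)) ?_
      omega)
    (by
      intro a b t h
      have h := mem_normalForm.1 h
      refine congrArg (fun m : ℕ => C₂ + (m : ZMod n)) ?_
      omega)
    (by
      intro a b
      have ha := bounds a
      have hb := bounds b
      -- Both sides can only be the vertex `(a, b + 1)` with `a` and `b` odd. On the left, `a - 1`
      -- is even and less than `e`, so that pair must be rewritten; on the right, `b + 1` is even
      -- and exceeds `s₂`, which forces `a` odd and `s < a`.
      ext u
      have h1 := u.2.fst
      have h2 := u.2.snd
      have h3 := u.2.snd_le
      refine Option.bind_eq_some_iff.trans (Iff.trans ?_ Option.bind_eq_some_iff.symm)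
      constructor
      · rintro ⟨a', ha', hu⟩
        replace ha' := mem_R.1 ha'
        replace hu := mem_normalForm.1 hu
        exact ⟨⟨b.1 + 1, Finset.mem_Icc.2 (by omega)⟩, mem_L.2 (by dsimp only; omega),
          mem_normalForm.2 (by dsimp only; omega)⟩
      · rintro ⟨b', hb', hu⟩
        replace hb' := mem_L.1 hb'
        replace hu := mem_normalForm.1 hu
        exact ⟨⟨a.1 - 1, Finset.mem_Icc.2 (by omega)⟩, mem_R.2 (by dsimp only; omega),
          mem_normalForm.2 (by dsimp only; omega)⟩)
    (fun t => mem_normalForm.2 (Or.inl ⟨rfl, rfl⟩))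
    (BX.tensorMk_zigzag BY)
    (by
      intro t
      ext u
      refine (mem_tensorDatum_L R C₂).trans (Iff.trans ?_ Option.bind_eq_some_iff.symm)
      have h1 := u.2.fst_le
      have h2 := t.2.le_fst
      constructor
      · intro hu
        exact ⟨⟨t.1.1 + 1, Finset.mem_Icc.2 (by omega)⟩, mem_L.2 ⟨hu.1, rfl⟩,
          mem_normalForm.2 (by simp only [TensorVertex.snd]; omega)⟩
      · rintro ⟨a, ha, hu⟩
        replace ha := mem_L.1 ha
        replace hu := mem_normalForm.1 hu
        simp only [TensorVertex.fst, TensorVertex.snd] at ha hu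
        omega)
    (by
      intro t
      ext u
      refine (mem_tensorDatum_R R C₂).trans (Iff.trans ?_ Option.bind_eq_some_iff.symm)
      have h1 := u.2.le_snd
      have h2 := t.2.snd_le
      constructor
      · intro hu
        exact ⟨⟨t.1.2 - 1, Finset.mem_Icc.2 (by omega)⟩,
          mem_R.2 (by simp only [TensorVertex.snd]; omega),
          mem_normalForm.2 (by simp only [TensorVertex.fst]; omega)⟩
      · rintro ⟨b, hb, hu⟩
        replace hb := mem_R.1 hb
        replace hu := mem_normalForm.1 hu
        simp only [TensorVertex.fst, TensorVertex.snd] at hb hu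
        omega)

end MonomialBasis

/-! ### Recognition of string bimodules -/

namespace MonomialBasis

variable {k : Type u} [Field k] {n : ℕ} {W : Bimodule k (NakayamaAlgebra k n)}
  {D : MonomialDatum n}

/-- A bimodule whose basis is indexed by an interval of the infinite zigzag walk is a string
bimodule. -/
theorem isString (B : MonomialBasis W D) [Nonempty D.S] (R C : ZMod n) (τ : D.S → ℕ)
    (hτ : Function.Injective τ) (hrow : ∀ s, D.row s = R + ((τ s / 2 : ℕ) : ZMod n))
    (hcol : ∀ s, D.col s = C + (((τ s + 1) / 2 : ℕ) : ZMod n))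
    (hL : ∀ s t, t ∈ D.L s ↔ τ s % 2 = 1 ∧ τ t = τ s + 1)
    (hR : ∀ s t, t ∈ D.R s ↔ τ s % 2 = 1 ∧ τ t + 1 = τ s)
    (hconn : ∀ s t, τ s < τ t → ∃ u, τ u = τ s + 1) : W.IsString := by
  obtain ⟨s₀, h₀⟩ := Finite.exists_min τ
  obtain ⟨s₁, h₁⟩ := Finite.exists_max τ
  have hle := h₀ s₁
  let φ : D.S ≃ (zigzag R C (τ s₀) (τ s₁)).S := Equiv.ofBijective
    (fun s => ⟨τ s, Finset.mem_Icc.2 ⟨h₀ s, h₁ s⟩⟩)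
    ⟨fun s t h => hτ (congrArg Subtype.val h), by
      -- Surjectivity: climbing from the minimum by `hconn` reaches every position up to the
      -- maximum.
      have : ∀ d, τ s₀ + d ≤ τ s₁ → ∃ s, τ s = τ s₀ + d := by
        intro d
        induction d with
        | zero => exact fun _ => ⟨s₀, rfl⟩
        | succ d ih =>
          intro h
          obtain ⟨s, hs⟩ := ih (by omega)
          obtain ⟨u, hu⟩ := hconn s s₁ (by omega)
          exact ⟨u, by omega⟩
      intro t
      have ht := zigzag.bounds t
      obtain ⟨s, hs⟩ := this (t.1 - τ s₀) (by omega)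
      exact ⟨s, Subtype.ext (by dsimp only; omega)⟩⟩
  have B' : MonomialBasis W (zigzag R C (τ s₀) (τ s₁)) :=
    B.reindex φ (fun s => (hrow s).symm) (fun s => (hcol s).symm)
      (fun s t => zigzag.mem_L.trans (hL s t).symm) (fun s t => zigzag.mem_R.trans (hR s t).symm)
  let r : StringDatum n :=
    { row := R + ((τ s₀ / 2 : ℕ) : ZMod n)
      col := C + (((τ s₀ + 1) / 2 : ℕ) : ZMod n)
      -- Steps to the right start at even positions of the zigzag.
      course := if τ s₀ % 2 = 0 then .right else .down
      length := τ s₁ - τ s₀ }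
  refine ⟨r, ⟨B'.iso (r.monomialBasis k ?_ ?_ rfl rfl)⟩⟩
  · simp only [StringDatum.start, r]
    split_ifs with h
    · exact h
    · simp only
      omega
  · simp only [r]
    omega

/-- A zero bimodule is split. -/
theorem isKSplit_of_isEmpty (B : MonomialBasis W D) [IsEmpty D.S] : W.IsKSplit :=
  B.isKSplit (D₁ := D) (D₂ := D) (Equiv.equivOfIsEmpty _ _) isEmptyElim isEmptyElim isEmptyElim
    isEmptyElim

end MonomialBasis

/-- The standard basis of a string bimodule. -/
noncomputable def StringDatum.standardBasis {n : ℕ} (r : StringDatum n) (k : Type u) [Field k] :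
    MonomialBasis (r.bimodule k) r.zigzag :=
  have := r.start_le
  r.monomialBasis k (by omega) rfl (by rw [Nat.div_eq_of_lt (by omega)]; simp)
    -- The walk enters the zigzag at position `start`, where the column has already advanced by
    -- `start`; the shift in `StringDatum.zigzag` undoes this.
    (by rw [show (r.start + 1) / 2 = r.start by omega]; simp)

/-- The inverse of an isomorphism of bimodules. -/
def Bimodule.Iso.symm {k A : Type u} [Field k] [Ring A] [Algebra k A] {X Y : Bimodule k A}
    (e : Iso X Y) : Iso Y X where
  toEquiv := e.toEquiv.symm
  map_left a x := by rw [LinearEquiv.symm_apply_eq, e.map_left, LinearEquiv.apply_symm_apply]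
  map_right a x := by rw [LinearEquiv.symm_apply_eq, e.map_right, LinearEquiv.apply_symm_apply]

/-! ### Decomposition of the tensor product along diagonals -/

namespace zigzag

variable {n : ℕ} (R C : ZMod n) (s e : ℕ) (R₂ C₂ : ZMod n) (s₂ e₂ : ℕ)

/-- The index of the diagonal in `ℤ²` that contains a vertex of a tensor product. -/
def diagonal (t : (tensorDatum R C s e R₂ C₂ s₂ e₂).S) : Fin (e + e₂ + 2) :=
  -- The summand `e₂` keeps the subtraction from truncating, since the second coordinate is at most
  -- `e₂`.
  ⟨(t.1.1 + 1) / 2 + e₂ - t.1.2 / 2, by have := t.2.fst_le; omega⟩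

variable {R C s e R₂ C₂ s₂ e₂} in
theorem diagonal_of_mem_L {t u : (tensorDatum R C s e R₂ C₂ s₂ e₂).S}
    (h : u ∈ (tensorDatum R C s e R₂ C₂ s₂ e₂).L t) :
    diagonal R C s e R₂ C₂ s₂ e₂ u = diagonal R C s e R₂ C₂ s₂ e₂ t := by
  rw [mem_tensorDatum_L] at h
  refine Fin.ext ?_
  simp only [diagonal]
  have := u.2.snd_le
  omega

variable {R C s e R₂ C₂ s₂ e₂} in
theorem diagonal_of_mem_R {t u : (tensorDatum R C s e R₂ C₂ s₂ e₂).S}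
    (h : u ∈ (tensorDatum R C s e R₂ C₂ s₂ e₂).R t) :
    diagonal R C s e R₂ C₂ s₂ e₂ u = diagonal R C s e R₂ C₂ s₂ e₂ t := by
  rw [mem_tensorDatum_R] at h
  refine Fin.ext ?_
  simp only [diagonal]
  omega

/-- The part of a tensor product of zigzags on a given diagonal. -/
noncomputable def tensorFiber (i : Fin (e + e₂ + 2)) : MonomialDatum n :=
  (tensorDatum R C s e R₂ C₂ s₂ e₂).fiber (diagonal R C s e R₂ C₂ s₂ e₂)
    diagonal_of_mem_L diagonal_of_mem_R i

/-- Comparison of cardinalities via natural numbers. -/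
theorem ncard_le_of_exists_val_eq {ι : Type*} {F : Finset ℕ} {S : Set ι} {f : ι → ℕ}
    (hf : S.InjOn f) {T : Set F} (h : ∀ t ∈ S, ∃ x ∈ T, x.1 = f t) : S.ncard ≤ T.ncard := by
  rw [← hf.ncard_image, ← Set.ncard_image_of_injective T Subtype.val_injective]
  refine Set.ncard_le_ncard ?_ (Set.toFinite _)
  rintro _ ⟨t, ht, rfl⟩
  exact h t ht

namespace tensorFiber

variable {R C s e R₂ C₂ s₂ e₂} {i : Fin (e + e₂ + 2)}

/-- The index in the first factor. -/
def a (t : (tensorFiber R C s e R₂ C₂ s₂ e₂ i).S) : ℕ := t.1.1.1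

/-- The index in the second factor. -/
def b (t : (tensorFiber R C s e R₂ C₂ s₂ e₂ i).S) : ℕ := t.1.1.2

theorem bounds (t : (tensorFiber R C s e R₂ C₂ s₂ e₂ i).S) :
    s ≤ a t ∧ a t ≤ e ∧ s₂ ≤ b t ∧ b t ≤ e₂ :=
  ⟨t.1.2.le_fst, t.1.2.fst_le, t.1.2.le_snd, t.1.2.snd_le⟩

theorem parity (t : (tensorFiber R C s e R₂ C₂ s₂ e₂ i).S) :
    (a t % 2 = 1 ∨ a t = e) ∧ ((a t % 2 = 1 ∧ s < a t) ∨ b t % 2 = 1 ∨ b t = s₂) :=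
  ⟨t.1.2.fst, t.1.2.snd⟩

theorem diagonal_eq (t : (tensorFiber R C s e R₂ C₂ s₂ e₂ i).S) :
    (a t + 1) / 2 + e₂ - b t / 2 = i :=
  congrArg Fin.val t.2

theorem ext {t u : (tensorFiber R C s e R₂ C₂ s₂ e₂ i).S} (h : a t = a u) (h' : b t = b u) :
    t = u :=
  Subtype.ext (Subtype.ext (Prod.ext h h'))

theorem exists_vertex (t : (tensorFiber R C s e R₂ C₂ s₂ e₂ i).S) (x y : ℕ)
    (h1 : s ≤ x ∧ x ≤ e ∧ s₂ ≤ y ∧ y ≤ e₂)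
    (h2 : (x + 1) / 2 + b t / 2 = (a t + 1) / 2 + y / 2)
    (h3 : x % 2 = 1 ∨ x = e) (h4 : (x % 2 = 1 ∧ s < x) ∨ y % 2 = 1 ∨ y = s₂) :
    ∃ u : (tensorFiber R C s e R₂ C₂ s₂ e₂ i).S, a u = x ∧ b u = y := by
  refine ⟨⟨⟨(x, y), t.1.2.congr h1 h2 h3 h4⟩, Fin.ext ?_⟩, rfl, rfl⟩
  have h5 := diagonal_eq t
  have := bounds t
  simp only [diagonal]
  omega

theorem mem_L {t u : (tensorFiber R C s e R₂ C₂ s₂ e₂ i).S} :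
    u ∈ (tensorFiber R C s e R₂ C₂ s₂ e₂ i).L t ↔ a t % 2 = 1 ∧
      ((a u = a t + 1 ∧ b u = b t) ∨ (b t % 2 = 1 ∧ a u = a t + 2 ∧ b u = b t + 1)) :=
  (MonomialDatum.mem_fiber_L _ _ diagonal_of_mem_L diagonal_of_mem_R _ _ _).trans
    (mem_tensorDatum_L R C₂)

theorem mem_R {t u : (tensorFiber R C s e R₂ C₂ s₂ e₂ i).S} :
    u ∈ (tensorFiber R C s e R₂ C₂ s₂ e₂ i).R t ↔ b t % 2 = 1 ∧ a u = a t ∧ b u + 1 = b t :=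
  (MonomialDatum.mem_fiber_R _ _ diagonal_of_mem_L diagonal_of_mem_R _ _ _).trans
    (mem_tensorDatum_R R C₂)

theorem row_eq (t : (tensorFiber R C s e R₂ C₂ s₂ e₂ i).S) :
    (tensorFiber R C s e R₂ C₂ s₂ e₂ i).row t = R + ((a t / 2 : ℕ) : ZMod n) := rfl

theorem col_eq (t : (tensorFiber R C s e R₂ C₂ s₂ e₂ i).S) :
    (tensorFiber R C s e R₂ C₂ s₂ e₂ i).col t = C₂ + (((b t + 1) / 2 : ℕ) : ZMod n) := rfl

variable {k : Type u} [Field k] {W : Bimodule k (NakayamaAlgebra k n)}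

/-- The position of a vertex on the infinite zigzag walk. -/
def position (t : (tensorFiber R C s e R₂ C₂ s₂ e₂ i).S) : ℕ := b t + (a t + 1) % 2

/-- Away from vertices with two even coordinates, `x_a ⊗ y_b` takes the place of `y_b` in its walk
when `a` is odd. The remaining vertices `x_e ⊗ y_b`, with `e` even and `b` odd, come one place
later, where the left arrow out of `x_{e-1} ⊗ y_b` would lead. -/
theorem position_cases (t : (tensorFiber R C s e R₂ C₂ s₂ e₂ i).S)
    (h : ¬ (a t % 2 = 0 ∧ b t % 2 = 0)) : (a t % 2 = 1 ∧ position t = b t) ∨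
      (a t % 2 = 0 ∧ a t = e ∧ b t % 2 = 1 ∧ position t = b t + 1) := by
  have := parity t
  simp only [position]
  omega

theorem diagonal_eq' (t u : (tensorFiber R C s e R₂ C₂ s₂ e₂ i).S) :
    (a t + 1) / 2 + b u / 2 = (a u + 1) / 2 + b t / 2 := by
  have := diagonal_eq t
  have := diagonal_eq u
  have := bounds t
  have := bounds u
  omega

theorem position_injective
    (h : ∀ t : (tensorFiber R C s e R₂ C₂ s₂ e₂ i).S, ¬ (a t % 2 = 0 ∧ b t % 2 = 0)) :
    Function.Injective (position : (tensorFiber R C s e R₂ C₂ s₂ e₂ i).S → ℕ) := by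
  intro t u htu
  have := bounds t
  have := bounds u
  have := diagonal_eq' t u
  rcases position_cases t (h t) with h1 | h1 <;> rcases position_cases u (h u) with h2 | h2 <;>
    exact ext (by omega) (by omega)

theorem mem_L_iff_position
    (h : ∀ t : (tensorFiber R C s e R₂ C₂ s₂ e₂ i).S, ¬ (a t % 2 = 0 ∧ b t % 2 = 0))
    (t u : (tensorFiber R C s e R₂ C₂ s₂ e₂ i).S) :
    u ∈ (tensorFiber R C s e R₂ C₂ s₂ e₂ i).L t ↔
      position t % 2 = 1 ∧ position u = position t + 1 := by
  have := bounds t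
  have := bounds u
  have := diagonal_eq' t u
  rw [mem_L]
  rcases position_cases t (h t) with h1 | h1 <;> rcases position_cases u (h u) with h2 | h2 <;>
    constructor <;> intro h3 <;> omega

theorem mem_R_iff_position
    (h : ∀ t : (tensorFiber R C s e R₂ C₂ s₂ e₂ i).S, ¬ (a t % 2 = 0 ∧ b t % 2 = 0))
    (t u : (tensorFiber R C s e R₂ C₂ s₂ e₂ i).S) :
    u ∈ (tensorFiber R C s e R₂ C₂ s₂ e₂ i).R t ↔
      position t % 2 = 1 ∧ position u + 1 = position t := by
  have := bounds t
  have := bounds u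
  have := diagonal_eq' t u
  rw [mem_R]
  rcases position_cases t (h t) with h1 | h1 <;> rcases position_cases u (h u) with h2 | h2 <;>
    constructor <;> intro h3 <;> omega

theorem exists_position_succ
    (h : ∀ t : (tensorFiber R C s e R₂ C₂ s₂ e₂ i).S, ¬ (a t % 2 = 0 ∧ b t % 2 = 0))
    (t u : (tensorFiber R C s e R₂ C₂ s₂ e₂ i).S)
    (htu : position t < position u) : ∃ v : (tensorFiber R C s e R₂ C₂ s₂ e₂ i).S,
      position v = position t + 1 := by
  have hbt := bounds t
  have hbu := bounds u
  have := diagonal_eq' t u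
  have hpt := parity t
  have hu := position_cases u (h u)
  rcases position_cases t (h t) with h1 | h1
  swap
  -- A vertex with first coordinate `e` even is the last of its diagonal, so nothing lies beyond it.
  · rcases hu with h2 | h2 <;> omega
  suffices H : ∃ x y, (s ≤ x ∧ x ≤ e ∧ s₂ ≤ y ∧ y ≤ e₂) ∧
      (x + 1) / 2 + b t / 2 = (a t + 1) / 2 + y / 2 ∧ (x % 2 = 1 ∨ x = e) ∧
      ((x % 2 = 1 ∧ s < x) ∨ y % 2 = 1 ∨ y = s₂) ∧ y + (x + 1) % 2 = b t + 1 by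
    obtain ⟨x, y, h2, h3, h4, h5, h6⟩ := H
    obtain ⟨v, rfl, rfl⟩ := exists_vertex t x y h2 h3 h4 h5
    exact ⟨v, by rw [h1.2]; exact h6⟩
  -- From `b` even, the successor is the vertex whose right arrow leads to `t`. From `b` odd, it is
  -- the target of the left arrow from `t`, in one of the two forms of `mem_L`; the vertex `u`
  -- further along guarantees that it stays in range.
  rcases Nat.mod_two_eq_zero_or_one (b t) with hb | hb
  · refine ⟨a t, b t + 1, ⟨by omega, by omega, by omega, ?_⟩, by omega, by omega, by omega,
      by omega⟩
    rcases hu with h2 | h2 <;> omega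
  by_cases hae : a t + 1 = e
  · exact ⟨a t + 1, b t, by omega, by omega, by omega, by omega, by omega⟩
  · refine ⟨a t + 2, b t + 1, ⟨by omega, ?_, by omega, ?_⟩, by omega, by omega, by omega,
      by omega⟩
    · rcases hu with h2 | h2 <;> omega
    · rcases hu with h2 | h2 <;> omega

theorem isString
    (h : ∀ t : (tensorFiber R C s e R₂ C₂ s₂ e₂ i).S, ¬ (a t % 2 = 0 ∧ b t % 2 = 0))
    (B : MonomialBasis W (tensorFiber R C s e R₂ C₂ s₂ e₂ i))
    [Nonempty (tensorFiber R C s e R₂ C₂ s₂ e₂ i).S] : W.IsString := by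
  -- The row offset solves `a / 2 + e₂ + 1 = i + position / 2`, the equation of the diagonal.
  refine B.isString (R + ((i : ℕ) : ZMod n) - e₂ - 1) C₂ position (position_injective h)
    (fun t => ?_) (fun t => ?_) (mem_L_iff_position h) (mem_R_iff_position h)
    (exists_position_succ h)
  · have := bounds t
    have := diagonal_eq t
    have h2 : a t / 2 + e₂ + 1 = i + position t / 2 := by
      rcases position_cases t (h t) with h1 | h1 <;> omega
    have h3 := congrArg (Nat.cast (R := ZMod n)) h2
    rw [Nat.cast_add, Nat.cast_add, Nat.cast_add, Nat.cast_one] at h3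
    rw [row_eq]
    linear_combination h3
  · rw [col_eq]
    congr 2
    rcases position_cases t (h t) with h1 | h1 <;> omega

/-- The part of a tensor product on the diagonal with a vertex with two even coordinates is a
product. -/
noncomputable def equivProd (t : (tensorFiber R C s e R₂ C₂ s₂ e₂ i).S)
    (ht : a t % 2 = 0 ∧ b t % 2 = 0) : (tensorFiber R C s e R₂ C₂ s₂ e₂ i).S ≃
      (zigzag R C (max s (e - 1)) e).S × (zigzag R₂ C₂ s₂ (min e₂ (s₂ + 1))).S :=
  Equiv.ofBijective
    (fun u => (⟨a u, by
      have := bounds t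
      have := bounds u
      have := parity t
      have := diagonal_eq t
      have := diagonal_eq u
      exact Finset.mem_Icc.2 (by omega)⟩, ⟨b u, by
      have := bounds t
      have := bounds u
      have := parity t
      have := diagonal_eq t
      have := diagonal_eq u
      exact Finset.mem_Icc.2 (by omega)⟩))
    ⟨fun u v h => ext (congrArg (fun x => x.1.1) h) (congrArg (fun x => x.2.1) h), by
      intro x
      have := bounds t
      have := parity t
      have := zigzag.bounds x.1
      have := zigzag.bounds x.2
      obtain ⟨u, hu, hu'⟩ := exists_vertex t x.1.1 x.2.1 (by omega) (by omega) (by omega) (by omega)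
      exact ⟨u, Prod.ext (Subtype.ext hu) (Subtype.ext hu')⟩⟩

/-- A vertex with two even coordinates is `(e, s₂)`. Its diagonal leaves room only for first
coordinates `e - 1`, `e` and second coordinates `s₂`, `s₂ + 1`. Moves by two in the first coordinate
cannot occur there, so the left arrow changes only the first coordinate and the right arrow only the
second. -/
theorem isKSplit (B : MonomialBasis W (tensorFiber R C s e R₂ C₂ s₂ e₂ i))
    (t : (tensorFiber R C s e R₂ C₂ s₂ e₂ i).S) (ht : a t % 2 = 0 ∧ b t % 2 = 0) :
    W.IsKSplit := by
  refine B.isKSplit (equivProd t ht) (fun _ => rfl) (fun _ => rfl) ?_ ?_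
  · intro u v
    refine mem_L.trans (Iff.trans ?_ (and_congr zigzag.mem_L Subtype.ext_iff).symm)
    change _ ↔ (a u % 2 = 1 ∧ a v = a u + 1) ∧ b v = b u
    have := bounds t
    have := bounds u
    have := bounds v
    have := parity t
    have := diagonal_eq t
    have := diagonal_eq u
    omega
  · intro u v
    refine mem_R.trans (Iff.trans ?_ (and_congr zigzag.mem_R Subtype.ext_iff).symm)
    change _ ↔ (b u % 2 = 1 ∧ b v + 1 = b u) ∧ a v = a u
    omega

theorem isString_or_isKSplit (B : MonomialBasis W (tensorFiber R C s e R₂ C₂ s₂ e₂ i)) :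
    W.IsString ∨ W.IsKSplit := by
  by_cases h : ∀ t : (tensorFiber R C s e R₂ C₂ s₂ e₂ i).S, ¬ (a t % 2 = 0 ∧ b t % 2 = 0)
  · rcases isEmpty_or_nonempty (tensorFiber R C s e R₂ C₂ s₂ e₂ i).S
    · exact Or.inr B.isKSplit_of_isEmpty
    · exact Or.inl (isString h B)
  · push Not at h
    obtain ⟨t, ht⟩ := h
    exact Or.inr (isKSplit B t ht)

/-! ### Bounds for height, width and valleys -/

/-- A commutative square is not a string. -/
theorem not_square (h : Nat.card (tensorFiber R C s e R₂ C₂ s₂ e₂ i).S =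
      (tensorFiber R C s e R₂ C₂ s₂ e₂ i).imL.ncard +
      (tensorFiber R C s e R₂ C₂ s₂ e₂ i).imR.ncard + 1)
    (t : (tensorFiber R C s e R₂ C₂ s₂ e₂ i).S) (ht : a t % 2 = 0 ∧ b t % 2 = 0) :
    ¬ (s < e ∧ s₂ < e₂) := by
  rintro ⟨hs, hs'⟩
  have h1 := bounds t
  have h2 := parity t
  -- The square has four vertices, but two of them lie in `imL` and two in `imR`, so the identity
  -- for strings would require at least five.
  have hcard : Nat.card (tensorFiber R C s e R₂ C₂ s₂ e₂ i).S = 4 := by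
    rw [Nat.card_congr (equivProd t ht), Nat.card_prod]
    have h3 : Nat.card (zigzag R C (max s (e - 1)) e).S = (Finset.Icc (max s (e - 1)) e).card :=
      Nat.card_eq_finsetCard _
    have h4 : Nat.card (zigzag R₂ C₂ s₂ (min e₂ (s₂ + 1))).S =
        (Finset.Icc s₂ (min e₂ (s₂ + 1))).card := Nat.card_eq_finsetCard _
    rw [h3, h4, Nat.card_Icc, Nat.card_Icc, show e + 1 - max s (e - 1) = 2 by omega,
      show min e₂ (s₂ + 1) + 1 - s₂ = 2 by omega]
  obtain ⟨t₀₀, h00, h00'⟩ := exists_vertex t (e - 1) s₂ (by omega) (by omega) (by omega) (by omega)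
  obtain ⟨t₀₁, h01, h01'⟩ := exists_vertex t (e - 1) (s₂ + 1) (by omega) (by omega) (by omega)
    (by omega)
  obtain ⟨t₁₁, h11, h11'⟩ := exists_vertex t e (s₂ + 1) (by omega) (by omega) (by omega) (by omega)
  have hL : ({t, t₁₁} : Set _).ncard ≤ (tensorFiber R C s e R₂ C₂ s₂ e₂ i).imL.ncard := by
    refine Set.ncard_le_ncard ?_ (Set.toFinite _)
    rintro u (rfl | rfl)
    · exact ⟨t₀₀, mem_L.2 (by omega)⟩
    · exact ⟨t₀₁, mem_L.2 (by omega)⟩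
  have hR : ({t, t₀₀} : Set _).ncard ≤ (tensorFiber R C s e R₂ C₂ s₂ e₂ i).imR.ncard := by
    refine Set.ncard_le_ncard ?_ (Set.toFinite _)
    rintro u (rfl | rfl)
    · exact ⟨t₁₁, mem_R.2 (by omega)⟩
    · exact ⟨t₀₁, mem_R.2 (by omega)⟩
  rw [Set.ncard_pair (by rintro rfl; omega)] at hL hR
  omega

/-- These are the two forms of the left action: ending at the even end `e`, or a rewritten product
`x_{a-1} ⊗ y_{b-1} = x_a ⊗ y_b`. -/
theorem imL_cases {t : (tensorFiber R C s e R₂ C₂ s₂ e₂ i).S}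
    (ht : t ∈ (tensorFiber R C s e R₂ C₂ s₂ e₂ i).imL) :
    (s < a t ∧ a t = e ∧ e % 2 = 0) ∨ (s + 1 < a t ∧ a t % 2 = 1 ∧ b t % 2 = 0 ∧ s₂ < b t) := by
  obtain ⟨u, hu⟩ := ht
  rw [mem_L] at hu
  have := bounds u
  have := parity t
  omega

theorem imR_spec {t : (tensorFiber R C s e R₂ C₂ s₂ e₂ i).S}
    (ht : t ∈ (tensorFiber R C s e R₂ C₂ s₂ e₂ i).imR) : b t % 2 = 0 ∧ b t < e₂ := by
  obtain ⟨u, hu⟩ := ht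
  rw [mem_R] at hu
  have := bounds u
  omega

/-- Two vertices of `imL` on one diagonal with the same `a / 2` can differ only if they are `(e,
s₂)` and `(e, s₂ + 1)` with `e` and `s₂` even, that is, on a full square, which `h` excludes. -/
theorem injOn_imL
    (h : ∀ t : (tensorFiber R C s e R₂ C₂ s₂ e₂ i).S, a t % 2 = 0 ∧ b t % 2 = 0 →
      ¬ (s < e ∧ s₂ < e₂)) :
    Set.InjOn (fun t => 2 * (a t / 2)) (tensorFiber R C s e R₂ C₂ s₂ e₂ i).imL := by
  intro t ht u hu htu
  have h1 := imL_cases ht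
  have h2 := imL_cases hu
  have := bounds t
  have := bounds u
  have := parity t
  have := parity u
  have := h t
  have := h u
  have := diagonal_eq' t u
  dsimp only at htu
  rcases h1 with h1 | h1 <;> rcases h2 with h2 | h2 <;> exact ext (by omega) (by omega)

/-- Equal second coordinates on one diagonal leave only the first coordinates `e - 1` and `e` with
`e` even. As `b` is even, this is again a full square. -/
theorem injOn_imR
    (h : ∀ t : (tensorFiber R C s e R₂ C₂ s₂ e₂ i).S, a t % 2 = 0 ∧ b t % 2 = 0 →
      ¬ (s < e ∧ s₂ < e₂)) : Set.InjOn b (tensorFiber R C s e R₂ C₂ s₂ e₂ i).imR := by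
  intro t ht u hu htu
  have h1 := imR_spec ht
  have h2 := imR_spec hu
  have := bounds t
  have := bounds u
  have := parity t
  have := parity u
  have := h t
  have := h u
  have := diagonal_eq' t u
  exact ext (by omega) htu

theorem ncard_imL_le
    (h : ∀ t : (tensorFiber R C s e R₂ C₂ s₂ e₂ i).S, a t % 2 = 0 ∧ b t % 2 = 0 →
      ¬ (s < e ∧ s₂ < e₂)) : (tensorFiber R C s e R₂ C₂ s₂ e₂ i).imL.ncard ≤
    (zigzag R C s e).imL.ncard := by
  refine ncard_le_of_exists_val_eq (injOn_imL h) fun t ht => ?_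
  have h1 := imL_cases ht
  have := bounds t
  -- The number `2 * (a / 2)` is `e` itself in the first case of `imL_cases` and `a - 1` in the
  -- second; in both it is the index of the first factor before rewriting, which lies in `imL` of
  -- `X`.
  exact ⟨⟨2 * (a t / 2), Finset.mem_Icc.2 (by omega)⟩, mem_imL.2 (by dsimp only; omega), rfl⟩

theorem ncard_imR_le
    (h : ∀ t : (tensorFiber R C s e R₂ C₂ s₂ e₂ i).S, a t % 2 = 0 ∧ b t % 2 = 0 →
      ¬ (s < e ∧ s₂ < e₂)) : (tensorFiber R C s e R₂ C₂ s₂ e₂ i).imR.ncard ≤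
    (zigzag R₂ C₂ s₂ e₂).imR.ncard := by
  refine ncard_le_of_exists_val_eq (injOn_imR h) fun t ht => ?_
  have h1 := imR_spec ht
  have := bounds t
  exact ⟨⟨b t, Finset.mem_Icc.2 (by omega)⟩, mem_imR.2 h1, rfl⟩

/-- The first case of `imL_cases` would give two even coordinates with `s < e` and `s₂ < e₂`, a full
square; so a valley is a rewritten product. Then `a - 1` is a valley of `X` and `b` a valley of `Y`.
-/
theorem imL_inter_imR_spec
    (h : ∀ t : (tensorFiber R C s e R₂ C₂ s₂ e₂ i).S, a t % 2 = 0 ∧ b t % 2 = 0 →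
      ¬ (s < e ∧ s₂ < e₂))
    {t : (tensorFiber R C s e R₂ C₂ s₂ e₂ i).S}
    (ht : t ∈ (tensorFiber R C s e R₂ C₂ s₂ e₂ i).imL ∩ (tensorFiber R C s e R₂ C₂ s₂ e₂ i).imR) :
    s + 1 < a t ∧ a t % 2 = 1 ∧ b t % 2 = 0 ∧ s₂ < b t ∧ b t < e₂ := by
  have h1 := imL_cases ht.1
  have h2 := imR_spec ht.2
  have := bounds t
  have := parity t
  have := h t
  omega

theorem ncard_imL_inter_imR_le_fst
    (h : ∀ t : (tensorFiber R C s e R₂ C₂ s₂ e₂ i).S, a t % 2 = 0 ∧ b t % 2 = 0 →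
      ¬ (s < e ∧ s₂ < e₂)) :
    ((tensorFiber R C s e R₂ C₂ s₂ e₂ i).imL ∩ (tensorFiber R C s e R₂ C₂ s₂ e₂ i).imR).ncard ≤
      ((zigzag R C s e).imL ∩ (zigzag R C s e).imR).ncard := by
  refine ncard_le_of_exists_val_eq ((injOn_imL h).mono Set.inter_subset_left) fun t ht => ?_
  have h1 := imL_inter_imR_spec h ht
  have := bounds t
  exact ⟨⟨2 * (a t / 2), Finset.mem_Icc.2 (by omega)⟩,
    ⟨mem_imL.2 (by dsimp only; omega), mem_imR.2 (by dsimp only; omega)⟩, rfl⟩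

theorem ncard_imL_inter_imR_le_snd
    (h : ∀ t : (tensorFiber R C s e R₂ C₂ s₂ e₂ i).S, a t % 2 = 0 ∧ b t % 2 = 0 →
      ¬ (s < e ∧ s₂ < e₂)) :
    ((tensorFiber R C s e R₂ C₂ s₂ e₂ i).imL ∩ (tensorFiber R C s e R₂ C₂ s₂ e₂ i).imR).ncard ≤
      ((zigzag R₂ C₂ s₂ e₂).imL ∩ (zigzag R₂ C₂ s₂ e₂).imR).ncard := by
  refine ncard_le_of_exists_val_eq ((injOn_imR h).mono Set.inter_subset_right) fun t ht => ?_
  have h1 := imL_inter_imR_spec h ht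
  have := bounds t
  exact ⟨⟨b t, Finset.mem_Icc.2 (by omega)⟩,
    ⟨mem_imL.2 (by dsimp only; omega), mem_imR.2 (by dsimp only; omega)⟩, rfl⟩

end tensorFiber

end zigzag

theorem proposition3p5 (k : Type u) [Field k] [IsAlgClosed k] [CharZero k] (n : ℕ) [NeZero n]
    (X Y : Bimodule k (NakayamaAlgebra k n)) (p q : StringDatum n)
    (hX : Nonempty (Bimodule.Iso X (p.bimodule k)))
    (hY : Nonempty (Bimodule.Iso Y (q.bimodule k))) :
    ∃ (m : ℕ) (Z : Fin m → Bimodule k (NakayamaAlgebra k n)),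
      Nonempty (Bimodule.Iso (Bimodule.tensor X Y) (Bimodule.directSum Z)) ∧
      (∀ i, (Z i).IsString ∨ (Z i).IsKSplit) ∧
      ∀ (i : Fin m) (r : StringDatum n), Nonempty (Bimodule.Iso (Z i) (r.bimodule k)) →
        (r.valleys ≤ q.valleys ∧ r.width ≤ q.width) ∧
        (r.valleys ≤ p.valleys ∧ r.height ≤ p.height) := by
  obtain ⟨eX⟩ := hX
  obtain ⟨eY⟩ := hY
  let BX : MonomialBasis X p.zigzag := (p.standardBasis k).ofIso eX.symm
  let BY : MonomialBasis Y q.zigzag := (q.standardBasis k).ofIso eY.symm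
  refine ⟨_, fun i => (zigzag.tensorFiber p.row (p.col - p.start) p.start (p.start + p.length)
    q.row (q.col - q.start) q.start (q.start + q.length) i).bimodule k,
    ⟨(BX.zigzagTensor BY).iso (MonomialBasis.directSumFiber _ _ zigzag.diagonal_of_mem_L
      zigzag.diagonal_of_mem_R)⟩,
    fun i => zigzag.tensorFiber.isString_or_isKSplit (MonomialBasis.standard _), ?_⟩
  rintro i r ⟨e⟩
  have B := (MonomialBasis.standard _).ofIso e
  have Br := r.standardBasis k
  -- The summand may be one of the split ones; being isomorphic to a string bimodule, it satisfies
  -- the dimension identity and so is not a full square.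
  have h := zigzag.tensorFiber.not_square (by
    rw [B.natCard_eq Br, B.ncard_imL_eq Br, B.ncard_imR_eq Br, r.natCard_eq])
  rw [r.valleys_eq, r.width_eq, r.height_eq, ← B.ncard_imL_inter_imR_eq Br, ← B.ncard_imL_eq Br,
    ← B.ncard_imR_eq Br, p.valleys_eq, p.height_eq, q.valleys_eq, q.width_eq]
  exact ⟨⟨zigzag.tensorFiber.ncard_imL_inter_imR_le_snd h,
      Nat.succ_le_succ (zigzag.tensorFiber.ncard_imR_le h)⟩,
    zigzag.tensorFiber.ncard_imL_inter_imR_le_fst h,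
    Nat.succ_le_succ (zigzag.tensorFiber.ncard_imL_le h)⟩
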